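/- Let $b>a>0$ and $\nu>1$, and put $\tau(t)=t^{\nu}$ for $t=1,2,\dots$. Let $X_1,X_2,\dots$ be i.i.d. non-negative random variables and let $Y_1,Y_2,\dots$ be i.i.d. non-negative random variables, the two sequences being independent of each other. Let $H_{X,Y}$ be the random bipartite graph with parts $V=\{v_1,v_2,\dots\}$ and $W=\{w_1,w_2,\dots\}$ in which, given $X=(X_i)_{i\ge1}$ and $Y=(Y_j)_{j\ge1}$, the edges $\{w_i,v_j\}$ are present independently of each other, with probabilities $$p_{ij}=\min\Bigl\{1,\frac{X_iY_j}{\sqrt{ij}}\Bigr\}\,\mathbb I_{\{a\tau(j)\le i\le b\tau(j)\}},\qquad i,j\ge 1.$$ Let $G_{X,Y}$ be the random intersection graph on the vertex set $V$ in which two distinct vertices are adjacent whenever they have a common neighbour in $H_{X,Y}$, and let $d(v_t)$ denote the degree of $v_t$ in $G_{X,Y}$ (which is almost surely finite). Suppose that $a_2:=\mathbf E X_1^2<\infty$ and $b_1:=\mathbf E Y_1<\infty$. Then, as $t\to+\infty$, the random variable $d(v_t)$ converges in distribution to a random variable $\Lambda_3$ with the mixed Poisson distribution $$\mathbf P(\Lambda_3=r)=\mathbf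 E\, e^{-\lambda_3}\frac{\lambda_3^r}{r!},\qquad r=0,1,2,\dots,$$ where $\lambda_3=\gamma\, a_2\, b_1\, Y_1$ and $$\gamma=4\nu\bigl(b^{1/(2\nu)}-a^{1/(2\nu)}\bigr)\bigl(a^{-1/(2\nu)}-b^{-1/(2\nu)}\bigr).$$ -/

import Mathlib

open MeasureTheory ProbabilityTheory Filter

namespace RandomIntersection

/-- The probability of the edge `{w_i, v_j}` in the bipartite graph with item weight `x = x_i` and
actor weight `y = y_j`: it is `min {1, x y / √(i j)}` if `a τ(j) ≤ i ≤ b τ(j)`, and `0` otherwise.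
Items and actors are indexed by the positive integers. -/
noncomputable def edgeProb (a b : ℝ) (τ : ℕ+ → ℝ) (i j : ℕ+) (x y : ℝ) : ℝ :=
  open Classical in
  if a * τ j ≤ (i : ℝ) ∧ (i : ℝ) ≤ b * τ j then min 1 (x * y / √((i : ℝ) * (j : ℝ))) else 0

/-- The σ-algebra generated by the two weight sequences. -/
abbrev weightSigma {Ω : Type*} (X Y : ℕ+ → Ω → ℝ) : MeasurableSpace Ω :=
  MeasurableSpace.comap (fun ω => ((fun i => X i ω), (fun j => Y j ω)))
    (inferInstance : MeasurableSpace ((ℕ+ → ℝ) × (ℕ+ → ℝ)))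

/-- `H i j` is the event that the edge `{w_i, v_j}` is present. The random bipartite graph is
`H_{X,Y}`: given the weights, the edges are independent, and `{w_i, v_j}` is present with
probability `edgeProb a b τ i j (X i) (Y j)`. Conditional independence of events is the product
formula for finite subfamilies; the one-element subfamilies give the probabilities themselves. -/
structure IsRandomBipartiteGraph {Ω : Type*} {mΩ : MeasurableSpace Ω} (μ : Measure Ω)
    (a b : ℝ) (τ : ℕ+ → ℝ) (X Y : ℕ+ → Ω → ℝ) (H : ℕ+ → ℕ+ → Set Ω) : Prop where
  measurableSet_edge : ∀ i j, MeasurableSet (H i j)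
  condProb_edges : ∀ S : Finset (ℕ+ × ℕ+),
    μ⟦⋂ e ∈ S, H e.1 e.2 | weightSigma X Y⟧
      =ᵐ[μ] fun ω => ∏ e ∈ S, edgeProb a b τ e.1 e.2 (X e.1 ω) (Y e.2 ω)

/-- The random intersection graph on the actors `v_1, v_2, …`: two distinct actors are adjacent
when they have a common neighbour (an item) in the bipartite graph. -/
def intersectionGraph {Ω : Type*} (H : ℕ+ → ℕ+ → Set Ω) (ω : Ω) : SimpleGraph ℕ+ where
  Adj u v := u ≠ v ∧ ∃ i, ω ∈ H i u ∧ ω ∈ H i v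
  symm := ⟨fun _ _ h => ⟨h.1.symm, h.2.imp fun _ hi => ⟨hi.2, hi.1⟩⟩⟩
  loopless := ⟨fun _ h => h.1 rfl⟩

/-- The degree `d(v_t)` of the actor `v_t` in the random intersection graph. -/
noncomputable def degree {Ω : Type*} (H : ℕ+ → ℕ+ → Set Ω) (t : ℕ+) (ω : Ω) : ℕ :=
  ((intersectionGraph H ω).neighborSet t).ncard

/-- The constant `γ = 4ν (b^{1/(2ν)} - a^{1/(2ν)}) (a^{-1/(2ν)} - b^{-1/(2ν)})`. -/
noncomputable def gammaConst (a b ν : ℝ) : ℝ :=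
  4 * ν * (b ^ (1 / (2 * ν)) - a ^ (1 / (2 * ν))) * (a ^ (-(1 / (2 * ν))) - b ^ (-(1 / (2 * ν))))

/-- The random mean `λ₃ = γ a₂ b₁ Y₁`, where `a₂ = E X₁²` and `b₁ = E Y₁`. -/
noncomputable def limitMean {Ω : Type*} {mΩ : MeasurableSpace Ω} (μ : Measure Ω)
    (a b ν : ℝ) (X Y : ℕ+ → Ω → ℝ) (ω : Ω) : ℝ :=
  gammaConst a b ν * (∫ ω', X 1 ω' ^ 2 ∂μ) * (∫ ω', Y 1 ω' ∂μ) * Y 1 ω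

end RandomIntersection

/-! Only items `i` of order `t ^ ν` can be adjacent to `v_t`, and these reach only actors `u` of
order `t`; the edge probabilities involved are of order `t ^ (-(ν + 1) / 2)`. Hence the probability
that some actor shares two items with `v_t` tends to `0`, and the degree may be replaced by the
number of paths `v_t w_i v_u` (`degree_eq_card_paths`, `IsBoundedModel.measureReal_two_common_le`).

Given the weights, the number of paths is a sum over items of independent terms, each a Bernoulli
variable times a sum of Bernoulli variables. Its generating function `compoundGen` is close to `exp
((z - 1) S)`, where `S` is the conditional mean number of paths (`norm_compoundGen_sub_exp_le`). The
generating function is affine in each edge indicator, so its mean is determined by the joint edge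
probabilities alone (`integral_multiAffine`).

For bounded weights and large `t` the minimum in the edge probability is inactive, and `S` is `Y_t`
times a weighted sum of the `X_i ^ 2 * Y_u`. The weights add up to `γ` in the limit
(`tendsto_sum_inBand`), and a second moment bound replaces `X_i ^ 2 * Y_u` by its mean `a₂ b₁`
(`sq_integral_abs_sum_sq_mul_sub_le`). Since `Y_t` is distributed as `Y_1`, the generating functions
converge to `E exp ((z - 1) λ₃)`.

General weights are cut at a level `M` by deleting the edges at vertices of weight outside `[0, M]`.
The effect on the degree is bounded by tail moments, for all large `t` at once
(`norm_integral_pow_degree_sub_truncEdge_le`), so `M` can go to infinity after `t`. On the unit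
circle the generating functions are characteristic functions, and Lévy's continuity theorem gives
convergence in distribution. -/

namespace RandomIntersection

open scoped Topology

/-! ### Sums of powers over the integers of a real interval -/

/-- The positive integers in the real interval `[A, B]`. -/
noncomputable def pnatIcc (A B : ℝ) : Finset ℕ+ :=
  {n ∈ Finset.Icc 1 (⌊B⌋₊.succPNat) | A ≤ (n : ℝ) ∧ (n : ℝ) ≤ B}

theorem mem_pnatIcc {A B : ℝ} {n : ℕ+} : n ∈ pnatIcc A B ↔ A ≤ (n : ℝ) ∧ (n : ℝ) ≤ B := by
  simp only [pnatIcc, Finset.mem_filter, Finset.mem_Icc, one_le, true_and, and_iff_right_iff_imp]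
  rintro ⟨-, h⟩
  have h1 : (n : ℕ) ≤ ⌊B⌋₊ := Nat.le_floor h
  rw [← PNat.coe_le_coe]
  simp only [Nat.succPNat_coe]
  omega

theorem map_pnatIcc {A B : ℝ} (hA : 0 < A) :
    (pnatIcc A B).map ⟨PNat.val, PNat.coe_injective⟩ = Finset.Ico ⌈A⌉₊ (⌊B⌋₊ + 1) := by
  ext n
  simp only [Finset.mem_map, mem_pnatIcc, Function.Embedding.coeFn_mk, Finset.mem_Ico]
  constructor
  · rintro ⟨m, ⟨h1, h2⟩, rfl⟩
    exact ⟨Nat.ceil_le.2 h1, Nat.lt_succ_of_le (Nat.le_floor h2)⟩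
  · rintro ⟨h1, h2⟩
    have hn : 0 < n := lt_of_lt_of_le (Nat.ceil_pos.2 hA) h1
    refine ⟨⟨n, hn⟩, ⟨Nat.ceil_le.1 h1, ?_⟩, rfl⟩
    exact (Nat.le_floor_iff' hn.ne').1 (Nat.lt_succ_iff.1 h2)

theorem sum_pnatIcc {A B : ℝ} (hA : 0 < A) (f : ℕ → ℝ) :
    ∑ n ∈ pnatIcc A B, f n = ∑ n ∈ Finset.Ico ⌈A⌉₊ (⌊B⌋₊ + 1), f n := by
  rw [← map_pnatIcc hA, Finset.sum_map]
  rfl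

theorem card_pnatIcc_le {A B : ℝ} (hB : 0 ≤ B) : ((pnatIcc A B).card : ℝ) ≤ B := by
  have h : (pnatIcc A B).card ≤ (Finset.Icc 1 ⌊B⌋₊).card := by
    refine Finset.card_le_card_of_injOn PNat.val (fun n hn => ?_) (PNat.coe_injective.injOn)
    rw [Finset.mem_coe, mem_pnatIcc] at hn
    simp only [Finset.coe_Icc, Set.mem_Icc]
    exact ⟨n.pos, Nat.le_floor hn.2⟩
  rw [Nat.card_Icc, Nat.add_sub_cancel] at h
  exact (Nat.cast_le.2 h).trans (Nat.floor_le hB)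

/-- Bernoulli's inequality for an exponent in `(0, 1)`. With `le_rpow_succ_sub` it compares `n ^ (s
- 1)` with increments of `x ^ s / s`, so that the sums telescope and no integral is needed. -/
theorem rpow_succ_sub_le {x s : ℝ} (hx : 0 < x) (hs : 0 < s) (hs1 : s < 1) :
    ((x + 1) ^ s - x ^ s) / s ≤ x ^ (s - 1) := by
  have h := rpow_one_add_le_one_add_mul_self (s := 1 / x) (p := s)
    (by have := one_div_pos.2 hx; linarith) hs.le hs1.le
  have e : (x + 1) ^ s = x ^ s * (1 + 1 / x) ^ s := by
    rw [← Real.mul_rpow hx.le (by positivity)]; congr 1; field_simp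
  rw [div_le_iff₀ hs, e, Real.rpow_sub_one hx.ne']
  have := mul_le_mul_of_nonneg_left h (Real.rpow_nonneg hx.le s)
  calc _ ≤ x ^ s * (1 + s * (1 / x)) - x ^ s := by linarith
    _ = _ := by field_simp; ring

theorem le_rpow_succ_sub {x s : ℝ} (hx : 0 ≤ x) (hs : 0 < s) (hs1 : s < 1) :
    (x + 1) ^ (s - 1) ≤ ((x + 1) ^ s - x ^ s) / s := by
  have hx1 : 0 < x + 1 := by linarith
  have hle : (1 : ℝ) / (x + 1) ≤ 1 := by rw [div_le_one hx1]; linarith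
  have h := rpow_one_add_le_one_add_mul_self (s := -(1 / (x + 1))) (p := s)
    (by linarith) hs.le hs1.le
  have e : x ^ s = (x + 1) ^ s * (1 + -(1 / (x + 1))) ^ s := by
    rw [← Real.mul_rpow hx1.le (by linarith)]; congr 1; field_simp; ring
  rw [le_div_iff₀ hs, Real.rpow_sub_one hx1.ne']
  have := mul_le_mul_of_nonneg_left h (Real.rpow_nonneg hx1.le s)
  rw [← e] at this
  calc _ = (x + 1) ^ s - (x + 1) ^ s * (1 + s * -(1 / (x + 1))) := by field_simp; ring
    _ ≤ _ := by linarith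

theorem le_sum_Ico_rpow {s : ℝ} (hs : 0 < s) (hs1 : s < 1) {N K : ℕ} (hN : 0 < N) (hNK : N ≤ K) :
    ((K : ℝ) ^ s - (N : ℝ) ^ s) / s ≤ ∑ n ∈ Finset.Ico N K, (n : ℝ) ^ (s - 1) := by
  induction K, hNK using Nat.le_induction with
  | base => simp
  | succ k hk ih =>
    rw [Finset.sum_Ico_succ_top hk]
    have := rpow_succ_sub_le (x := k) (by exact_mod_cast hN.trans_le hk) hs hs1
    push_cast
    calc _ = (((k : ℝ) + 1) ^ s - (k : ℝ) ^ s) / s + ((k : ℝ) ^ s - (N : ℝ) ^ s) / s := by ring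
      _ ≤ _ := by linarith

theorem sum_Ico_rpow_le {s : ℝ} (hs : 0 < s) (hs1 : s < 1) {N K : ℕ} (hNK : N ≤ K) :
    ∑ n ∈ Finset.Ico N (K + 1), (n : ℝ) ^ (s - 1) ≤
      (N : ℝ) ^ (s - 1) + ((K : ℝ) ^ s - (N : ℝ) ^ s) / s := by
  induction K, hNK using Nat.le_induction with
  | base => simp
  | succ k hk ih =>
    rw [Finset.sum_Ico_succ_top (by omega)]
    have := le_rpow_succ_sub (x := k) (by positivity) hs hs1
    push_cast
    calc _ ≤ (N : ℝ) ^ (s - 1) + ((k : ℝ) ^ s - (N : ℝ) ^ s) / s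
          + (((k : ℝ) + 1) ^ s - (k : ℝ) ^ s) / s := by linarith
      _ = _ := by ring

/-- The summand decreases, so rounding the endpoints costs at most one term, and the largest
possible term is the one at the left end. -/
theorem abs_sum_pnatIcc_rpow_sub_le {s A B : ℝ} (hs : 0 < s) (hs1 : s < 1) (hA : 0 < A)
    (hAB : A ≤ B) :
    |∑ n ∈ pnatIcc A B, (n : ℝ) ^ (s - 1) - (B ^ s - A ^ s) / s| ≤ A ^ (s - 1) := by
  rw [sum_pnatIcc (B := B) hA (fun n => (n : ℝ) ^ (s - 1))]
  have hN : 0 < ⌈A⌉₊ := Nat.ceil_pos.2 hA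
  have hB1 : B ≤ ((⌊B⌋₊ + 1 : ℕ) : ℝ) := by push_cast; exact (Nat.lt_floor_add_one B).le
  have hNK : ⌈A⌉₊ ≤ ⌊B⌋₊ + 1 := Nat.ceil_le.2 (hAB.trans hB1)
  have hA1 : A ^ s ≤ (⌈A⌉₊ : ℝ) ^ s := Real.rpow_le_rpow hA.le (Nat.le_ceil A) hs.le
  have hA2 : (⌈A⌉₊ : ℝ) ^ (s - 1) ≤ A ^ (s - 1) :=
    Real.rpow_le_rpow_of_nonpos hA (Nat.le_ceil A) (by linarith)
  rw [abs_le]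
  constructor
  · have h1 := le_sum_Ico_rpow hs hs1 hN hNK
    have h2 : B ^ s ≤ ((⌊B⌋₊ + 1 : ℕ) : ℝ) ^ s := Real.rpow_le_rpow (hA.le.trans hAB) hB1 hs.le
    have h3 : (⌈A⌉₊ : ℝ) ^ s ≤ (A + 1) ^ s :=
      Real.rpow_le_rpow (by positivity) (Nat.ceil_lt_add_one hA.le).le hs.le
    have h4 := rpow_succ_sub_le hA hs hs1
    have h5 : (B ^ s - (A + 1) ^ s) / s ≤
        (((⌊B⌋₊ + 1 : ℕ) : ℝ) ^ s - (⌈A⌉₊ : ℝ) ^ s) / s := by gcongr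
    have h6 : (B ^ s - A ^ s) / s = (B ^ s - (A + 1) ^ s) / s + ((A + 1) ^ s - A ^ s) / s := by ring
    linarith
  -- In the case of equality the interval contains no integer and the sum is empty.
  · rcases hNK.lt_or_eq with h | h
    · have h1 := sum_Ico_rpow_le hs hs1 (Nat.lt_succ_iff.1 h)
      have h2 : (⌊B⌋₊ : ℝ) ^ s ≤ B ^ s :=
        Real.rpow_le_rpow (by positivity) (Nat.floor_le (hA.le.trans hAB)) hs.le
      have h5 : ((⌊B⌋₊ : ℝ) ^ s - (⌈A⌉₊ : ℝ) ^ s) / s ≤ (B ^ s - A ^ s) / s := by gcongr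
      linarith
    · rw [h, Finset.Ico_self, Finset.sum_empty]
      have h5 : 0 ≤ (B ^ s - A ^ s) / s :=
        div_nonneg (sub_nonneg.2 (Real.rpow_le_rpow hA.le hAB hs.le)) hs.le
      have := Real.rpow_nonneg hA.le (s - 1)
      linarith

/-! ### Items and actors within reach of `v_t` -/

/-- The condition under which the edge `{w_i, v_j}` may be present, for `τ(t) = t ^ ν`. -/
def InBand (a b ν : ℝ) (i j : ℕ+) : Prop :=
  a * (j : ℝ) ^ ν ≤ (i : ℝ) ∧ (i : ℝ) ≤ b * (j : ℝ) ^ ν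

/-- The possible neighbours of `v_t`. -/
noncomputable def items (a b ν : ℝ) (t : ℕ+) : Finset ℕ+ :=
  pnatIcc (a * (t : ℝ) ^ ν) (b * (t : ℝ) ^ ν)

theorem mem_items {a b ν : ℝ} {i t : ℕ+} : i ∈ items a b ν t ↔ InBand a b ν i t := mem_pnatIcc

/-- A set of actors that contains all actors with a possible common neighbour with `v_t`. -/
noncomputable def actors (a b ν : ℝ) (t : ℕ+) : Finset ℕ+ :=
  (pnatIcc ((a / b) ^ (1 / ν) * t) ((b / a) ^ (1 / ν) * t)).erase t

section

variable {a b ν : ℝ}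

theorem inBand_iff (ha : 0 < a) (hab : a < b) (hν : 1 < ν) {i u : ℕ+} :
    InBand a b ν i u ↔ ((i : ℝ) / b) ^ (1 / ν) ≤ u ∧ (u : ℝ) ≤ ((i : ℝ) / a) ^ (1 / ν) := by
  have hb : 0 < b := ha.trans hab
  have hν0 : 0 < ν := by linarith
  have hu : (0 : ℝ) < u := by exact_mod_cast u.pos
  have hi : (0 : ℝ) < i := by exact_mod_cast i.pos
  rw [InBand, one_div, Real.rpow_inv_le_iff_of_pos (by positivity) hu.le hν0,
    Real.le_rpow_inv_iff_of_pos hu.le (by positivity) hν0, le_div_iff₀ ha, div_le_iff₀ hb,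
    mul_comm b, mul_comm a, and_comm]

theorem div_rpow_bounds (ha : 0 < a) (hab : a < b) (hν : 1 < ν) {i t : ℕ+}
    (hi : InBand a b ν i t) :
    (a / b) ^ (1 / ν) * t ≤ ((i : ℝ) / b) ^ (1 / ν) ∧
      ((i : ℝ) / a) ^ (1 / ν) ≤ (b / a) ^ (1 / ν) * t := by
  have hb : 0 < b := ha.trans hab
  have ht : (0 : ℝ) < t := by exact_mod_cast t.pos
  have hi0 : (0 : ℝ) < i := by exact_mod_cast i.pos
  have hν0 : 0 < ν := by linarith
  have key : ∀ c : ℝ, 0 < c → c ^ (1 / ν) * t = (c * (t : ℝ) ^ ν) ^ (1 / ν) := fun c hc => by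
    rw [Real.mul_rpow hc.le (by positivity), ← Real.rpow_mul ht.le, mul_one_div_cancel hν0.ne',
      Real.rpow_one]
  rw [key _ (by positivity), key _ (by positivity)]
  constructor
  · refine Real.rpow_le_rpow (by positivity) ?_ (by positivity)
    rw [div_mul_eq_mul_div]
    exact div_le_div_of_nonneg_right hi.1 hb.le
  · refine Real.rpow_le_rpow (by positivity) ?_ (by positivity)
    rw [div_mul_eq_mul_div]
    exact div_le_div_of_nonneg_right hi.2 ha.le

/-- Both `t ^ ν` and `u ^ ν` lie in `[i / b, i / a]`, so their ratio lies in `[a / b, b / a]`. -/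
theorem mem_actors (ha : 0 < a) (hab : a < b) (hν : 1 < ν) {i t u : ℕ+} (hut : u ≠ t)
    (hi : InBand a b ν i t) (hu : InBand a b ν i u) : u ∈ actors a b ν t := by
  rw [actors, Finset.mem_erase, mem_pnatIcc]
  have h1 := div_rpow_bounds ha hab hν hi
  have h2 := (inBand_iff ha hab hν).1 hu
  exact ⟨hut, h1.1.trans h2.1, h2.2.trans h1.2⟩

-- The whole window of actors allowed for `i` lies in the range used to define `actors`, so only `t`
-- itself is lost.
open Classical in
theorem filter_actors (ha : 0 < a) (hab : a < b) (hν : 1 < ν) {i t : ℕ+} (hi : InBand a b ν i t) :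
    {u ∈ actors a b ν t | InBand a b ν i u} =
      (pnatIcc (((i : ℝ) / b) ^ (1 / ν)) (((i : ℝ) / a) ^ (1 / ν))).erase t := by
  ext u
  rw [Finset.mem_filter, Finset.mem_erase, mem_pnatIcc, ← inBand_iff ha hab hν]
  refine ⟨fun h => ⟨Finset.ne_of_mem_erase h.1, h.2⟩, fun h => ⟨?_, h.2⟩⟩
  exact mem_actors ha hab hν h.1 hi h.2

theorem card_items_le (ha : 0 < a) (hab : a < b) (t : ℕ+) :
    ((items a b ν t).card : ℝ) ≤ b * (t : ℝ) ^ ν :=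
  card_pnatIcc_le (mul_nonneg (ha.trans hab).le (by positivity))

theorem card_actors_le (ha : 0 < a) (hab : a < b) (t : ℕ+) :
    ((actors a b ν t).card : ℝ) ≤ (b / a) ^ (1 / ν) * t := by
  refine le_trans ?_ (card_pnatIcc_le (A := (a / b) ^ (1 / ν) * t) (by
    have := ha.trans hab; positivity))
  exact_mod_cast Finset.card_erase_le

/-- The first constant of the error comes from the left end of the window, which is at least `(a /
b) ^ (1 / ν) * t`; the `+ 1` is the omitted term `u = t`. -/
theorem abs_sum_filter_actors_sub_le (ha : 0 < a) (hab : a < b) (hν : 1 < ν) {i t : ℕ+}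
    (hi : InBand a b ν i t) :
    |∑ u ∈ (pnatIcc (((i : ℝ) / b) ^ (1 / ν)) (((i : ℝ) / a) ^ (1 / ν))).erase t,
        (u : ℝ) ^ ((1 / 2 : ℝ) - 1) -
      2 * (a ^ (-(1 / (2 * ν))) - b ^ (-(1 / (2 * ν)))) * (i : ℝ) ^ (1 / (2 * ν))| ≤
      (((a / b) ^ (1 / ν)) ^ (-(1 / 2) : ℝ) + 1) * (t : ℝ) ^ (-(1 / 2) : ℝ) := by
  have hb : 0 < b := ha.trans hab
  have ht : (0 : ℝ) < t := by exact_mod_cast t.pos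
  have hi0 : (0 : ℝ) < i := by exact_mod_cast i.pos
  have hν0 : 0 < ν := by linarith
  have hmem : t ∈ pnatIcc (((i : ℝ) / b) ^ (1 / ν)) (((i : ℝ) / a) ^ (1 / ν)) := by
    rw [mem_pnatIcc, ← inBand_iff ha hab hν]; exact hi
  rw [Finset.sum_erase_eq_sub hmem]
  have h := abs_sum_pnatIcc_rpow_sub_le (s := 1 / 2) (A := ((i : ℝ) / b) ^ (1 / ν))
    (B := ((i : ℝ) / a) ^ (1 / ν)) (by norm_num) (by norm_num) (by positivity)
    (Real.rpow_le_rpow (by positivity) (by gcongr) (by positivity))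
  have key : ∀ c : ℝ, 0 < c → (((i : ℝ) / c) ^ (1 / ν)) ^ (1 / 2 : ℝ) =
      c ^ (-(1 / (2 * ν))) * (i : ℝ) ^ (1 / (2 * ν)) := fun c hc => by
    rw [← Real.rpow_mul (by positivity), show 1 / ν * (1 / 2) = 1 / (2 * ν) by field_simp,
      Real.div_rpow hi0.le hc.le, Real.rpow_neg hc.le]
    field_simp
  rw [key _ hb, key _ ha] at h
  have h2 : (((i : ℝ) / b) ^ (1 / ν)) ^ ((1 / 2 : ℝ) - 1) ≤
      ((a / b) ^ (1 / ν)) ^ (-(1 / 2) : ℝ) * (t : ℝ) ^ (-(1 / 2) : ℝ) := by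
    rw [← Real.mul_rpow (by positivity) ht.le]
    norm_num only
    exact Real.rpow_le_rpow_of_nonpos (by positivity)
      (by have := (div_rpow_bounds ha hab hν hi).1; norm_num at this ⊢; exact this) (by norm_num)
  have e : (1 / 2 : ℝ) - 1 = -(1 / 2) := by norm_num
  rw [e] at h h2 ⊢
  have h3 : (0 : ℝ) ≤ (t : ℝ) ^ (-(1 / 2) : ℝ) := by positivity
  rw [abs_le] at h ⊢
  constructor <;> linarith [h.1, h.2]

end

/-! ### Limit of the total path weight, and orders of the error terms -/

theorem tendsto_pnat_cast_rpow_neg {c : ℝ} (hc : 0 < c) :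
    Tendsto (fun t : ℕ+ => (t : ℝ) ^ (-c)) atTop (𝓝 0) :=
  (tendsto_rpow_neg_atTop hc).comp (tendsto_natCast_atTop_atTop.comp tendsto_PNat_val_atTop_atTop)

theorem tendsto_const_mul_pnat_cast_rpow_neg (C : ℝ) {c : ℝ} (hc : 0 < c) :
    Tendsto (fun t : ℕ+ => C * (t : ℝ) ^ (-c)) atTop (𝓝 0) := by
  simpa only [mul_zero] using (tendsto_pnat_cast_rpow_neg hc).const_mul C

section

variable {a b ν : ℝ}

theorem abs_sum_items_rpow_sub_le (ha : 0 < a) (hab : a < b) (hν : 1 < ν) (t : ℕ+) :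
    |∑ i ∈ items a b ν t, (i : ℝ) ^ (1 / (2 * ν) - 1) -
      2 * ν * (b ^ (1 / (2 * ν)) - a ^ (1 / (2 * ν))) * (t : ℝ) ^ (1 / 2 : ℝ)| ≤
      a ^ (1 / (2 * ν) - 1) := by
  have hb : 0 < b := ha.trans hab
  have ht : (0 : ℝ) < t := by exact_mod_cast t.pos
  have ht1 : (1 : ℝ) ≤ t := by exact_mod_cast t.2
  have hν0 : 0 < ν := by linarith
  have hs1 : 1 / (2 * ν) < 1 := by rw [div_lt_one (by positivity)]; linarith
  have h := abs_sum_pnatIcc_rpow_sub_le (s := 1 / (2 * ν)) (A := a * (t : ℝ) ^ ν)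
    (B := b * (t : ℝ) ^ ν) (by positivity) hs1 (by positivity) (by gcongr)
  have key : ∀ c : ℝ, 0 < c → (c * (t : ℝ) ^ ν) ^ (1 / (2 * ν)) =
      c ^ (1 / (2 * ν)) * (t : ℝ) ^ (1 / 2 : ℝ) := fun c hc => by
    rw [Real.mul_rpow hc.le (by positivity), ← Real.rpow_mul ht.le]
    congr 2; field_simp
  rw [key _ hb, key _ ha] at h
  have h2 : (a * (t : ℝ) ^ ν) ^ (1 / (2 * ν) - 1) ≤ a ^ (1 / (2 * ν) - 1) := by
    refine Real.rpow_le_rpow_of_nonpos ha ?_ (by linarith)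
    exact le_mul_of_one_le_right ha.le (Real.one_le_rpow ht1 hν0.le)
  have e : (b ^ (1 / (2 * ν)) * (t : ℝ) ^ (1 / 2 : ℝ) - a ^ (1 / (2 * ν)) * (t : ℝ) ^ (1 / 2 : ℝ))
      / (1 / (2 * ν)) = 2 * ν * (b ^ (1 / (2 * ν)) - a ^ (1 / (2 * ν))) * (t : ℝ) ^ (1 / 2 : ℝ) := by
    field_simp
  rw [e] at h
  exact h.trans h2

-- A path has weight `t ^ (-1/2) * i⁻¹ * u ^ (-1/2)`. Summing over `u` gives about `2 D i ^ (1 /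
-- (2ν))`; summing `i ^ (1 / (2ν) - 1)` over the items then gives a multiple of `t ^ (1/2)`. The
-- powers of `t` cancel and the constants multiply to `γ`.
open Classical in
theorem tendsto_sum_inBand (ha : 0 < a) (hab : a < b) (hν : 1 < ν) :
    Tendsto (fun t : ℕ+ => ∑ i ∈ items a b ν t, ∑ u ∈ actors a b ν t with InBand a b ν i u,
      (√((i : ℝ) * t))⁻¹ * (√((i : ℝ) * u))⁻¹) atTop (𝓝 (gammaConst a b ν)) := by
  have hb : 0 < b := ha.trans hab
  have hν0 : 0 < ν := by linarith
  set D : ℝ := a ^ (-(1 / (2 * ν))) - b ^ (-(1 / (2 * ν))) with hD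
  set C : ℝ := ((a / b) ^ (1 / ν)) ^ (-(1 / 2) : ℝ) + 1 with hC
  have hC0 : 0 ≤ C := by positivity
  rw [tendsto_iff_norm_sub_tendsto_zero]
  have hlim : Tendsto (fun t : ℕ+ => C * (b / a) * (t : ℝ) ^ (-1 : ℝ) +
      |2 * D| * a ^ (1 / (2 * ν) - 1) * (t : ℝ) ^ (-(1 / 2) : ℝ)) atTop (𝓝 0) := by
    simpa using ((tendsto_pnat_cast_rpow_neg one_pos).const_mul (C * (b / a))).add
      ((tendsto_pnat_cast_rpow_neg (c := 1 / 2) (by norm_num)).const_mul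
        (|2 * D| * a ^ (1 / (2 * ν) - 1)))
  refine squeeze_zero (fun t => norm_nonneg _) (fun t => ?_) hlim
  have ht : (0 : ℝ) < t := by exact_mod_cast t.pos
  set T : ℝ := (t : ℝ) ^ (-(1 / 2) : ℝ) with hT
  have hT0 : 0 < T := by positivity
  have hTT : T * T = (t : ℝ) ^ (-1 : ℝ) := by
    rw [hT, ← Real.rpow_add ht]; norm_num
  have hTh : T * (t : ℝ) ^ (1 / 2 : ℝ) = 1 := by
    rw [hT, ← Real.rpow_add ht]; norm_num
  have h1 : ∀ i ∈ items a b ν t, ∑ u ∈ actors a b ν t with InBand a b ν i u,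
      (√((i : ℝ) * t))⁻¹ * (√((i : ℝ) * u))⁻¹ = T * (i : ℝ)⁻¹ *
        ∑ u ∈ (pnatIcc (((i : ℝ) / b) ^ (1 / ν)) (((i : ℝ) / a) ^ (1 / ν))).erase t,
        (u : ℝ) ^ ((1 / 2 : ℝ) - 1) := fun i hi => by
    have hi0 : (0 : ℝ) < i := by exact_mod_cast i.pos
    rw [filter_actors ha hab hν (mem_items.1 hi), Finset.mul_sum]
    refine Finset.sum_congr rfl fun u _ => ?_
    have hu : (0 : ℝ) < u := by exact_mod_cast u.pos
    have e : ∀ x : ℝ, 0 < x → x ^ (-(1 / 2) : ℝ) = (√x)⁻¹ := fun x hx => by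
      rw [Real.rpow_neg hx.le, Real.sqrt_eq_rpow]
    rw [show (1 / 2 : ℝ) - 1 = -(1 / 2) by norm_num, hT, e _ ht, e _ hu, Real.sqrt_mul hi0.le,
      Real.sqrt_mul hi0.le]
    have := Real.mul_self_sqrt hi0.le
    have h3 := Real.sqrt_pos.2 hi0
    have h4 := Real.sqrt_pos.2 hu
    have h5 := Real.sqrt_pos.2 ht
    field_simp
    nlinarith
  rw [Finset.sum_congr rfl h1]
  have h2 : |∑ i ∈ items a b ν t, T * (i : ℝ)⁻¹ *
        ∑ u ∈ (pnatIcc (((i : ℝ) / b) ^ (1 / ν)) (((i : ℝ) / a) ^ (1 / ν))).erase t,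
        (u : ℝ) ^ ((1 / 2 : ℝ) - 1) -
      ∑ i ∈ items a b ν t, T * (i : ℝ)⁻¹ * (2 * D * (i : ℝ) ^ (1 / (2 * ν)))| ≤
      C * (b / a) * (t : ℝ) ^ (-1 : ℝ) := by
    rw [← Finset.sum_sub_distrib]
    refine (Finset.abs_sum_le_sum_abs _ _).trans ?_
    have h3 : ∀ i ∈ items a b ν t, |T * (i : ℝ)⁻¹ *
        ∑ u ∈ (pnatIcc (((i : ℝ) / b) ^ (1 / ν)) (((i : ℝ) / a) ^ (1 / ν))).erase t,
        (u : ℝ) ^ ((1 / 2 : ℝ) - 1) - T * (i : ℝ)⁻¹ * (2 * D * (i : ℝ) ^ (1 / (2 * ν)))| ≤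
        T * (a * (t : ℝ) ^ ν)⁻¹ * (C * T) := fun i hi => by
      have hi0 : (0 : ℝ) < i := by exact_mod_cast i.pos
      rw [← mul_sub, abs_mul, abs_of_nonneg (by positivity)]
      have h5 := (mem_items.1 hi).1
      gcongr
      exact abs_sum_filter_actors_sub_le ha hab hν (mem_items.1 hi)
    refine (Finset.sum_le_card_nsmul _ _ _ h3).trans ?_
    rw [nsmul_eq_mul, ← hTT]
    -- The number of items and the bound for `i⁻¹` cancel up to `b / a`, which leaves `T * T = 1 /
    -- t`.
    calc _ ≤ b * (t : ℝ) ^ ν * (T * (a * (t : ℝ) ^ ν)⁻¹ * (C * T)) := by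
          gcongr
          exact card_items_le ha hab t
      _ = _ := by field_simp
  have h3 : ∑ i ∈ items a b ν t, T * (i : ℝ)⁻¹ * (2 * D * (i : ℝ) ^ (1 / (2 * ν))) =
      2 * D * T * ∑ i ∈ items a b ν t, (i : ℝ) ^ (1 / (2 * ν) - 1) := by
    rw [Finset.mul_sum]
    refine Finset.sum_congr rfl fun i _ => ?_
    have hi0 : (0 : ℝ) < i := by exact_mod_cast i.pos
    rw [Real.rpow_sub_one hi0.ne']
    field_simp
  have h4 : |2 * D * T * ∑ i ∈ items a b ν t, (i : ℝ) ^ (1 / (2 * ν) - 1) - gammaConst a b ν| ≤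
      |2 * D| * a ^ (1 / (2 * ν) - 1) * T := by
    have e : gammaConst a b ν = 2 * D * T *
        (2 * ν * (b ^ (1 / (2 * ν)) - a ^ (1 / (2 * ν))) * (t : ℝ) ^ (1 / 2 : ℝ)) := by
      rw [gammaConst, ← hD]
      calc _ = 4 * ν * (b ^ (1 / (2 * ν)) - a ^ (1 / (2 * ν))) * D * (T * (t : ℝ) ^ (1 / 2 : ℝ)) := by
            rw [hTh]; ring
        _ = _ := by ring
    rw [e, ← mul_sub, abs_mul, abs_mul, abs_of_pos hT0, mul_right_comm]
    gcongr
    exact abs_sum_items_rpow_sub_le ha hab hν t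
  rw [h3] at h2
  rw [Real.norm_eq_abs]
  exact (abs_sub_le _ _ _).trans (add_le_add h2 h4)

/-- A bound for `1 / √(i j)` over the items `i` and the actors `j` that matter for `v_t`. -/
noncomputable def eta (a b ν : ℝ) (t : ℕ+) : ℝ :=
  (√(a * (a / b) ^ (1 / ν)))⁻¹ * (t : ℝ) ^ (-((ν + 1) / 2))

theorem eta_pos (ha : 0 < a) (hab : a < b) (t : ℕ+) : 0 < eta a b ν t := by
  have ht : (0 : ℝ) < t := by exact_mod_cast t.pos
  have hb : 0 < b := ha.trans hab
  unfold eta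
  have : 0 < a * (a / b) ^ (1 / ν) := by positivity
  have := Real.sqrt_pos.2 this
  positivity

/-- The items are at least `a * t ^ ν` and the actors at least `(a / b) ^ (1 / ν) * t`; their
product has order at least `t ^ (ν + 1)`. -/
theorem inv_sqrt_le_eta (ha : 0 < a) (hab : a < b) (hν : 1 < ν) {i t u : ℕ+}
    (hi : i ∈ items a b ν t) (hu : u = t ∨ u ∈ actors a b ν t) :
    (√((i : ℝ) * u))⁻¹ ≤ eta a b ν t := by
  have ht : (0 : ℝ) < t := by exact_mod_cast t.pos
  have hb : 0 < b := ha.trans hab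
  have hκ : (0 : ℝ) < (a / b) ^ (1 / ν) := by positivity
  have hu' : (a / b) ^ (1 / ν) * t ≤ u := by
    rcases hu with rfl | hu
    · refine mul_le_of_le_one_left ht.le (Real.rpow_le_one (by positivity) ?_ (by positivity))
      rw [div_le_one hb]; exact hab.le
    · exact (mem_pnatIcc.1 (Finset.mem_of_mem_erase hu)).1
  have e : (t : ℝ) ^ (-((ν + 1) / 2)) = (√((t : ℝ) ^ (ν + 1)))⁻¹ := by
    rw [Real.rpow_neg ht.le, Real.sqrt_eq_rpow, ← Real.rpow_mul ht.le]; congr 2; ring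
  rw [eta, e, ← mul_inv, ← Real.sqrt_mul (by positivity)]
  have hpos : 0 < a * (a / b) ^ (1 / ν) * (t : ℝ) ^ (ν + 1) := by positivity
  refine inv_anti₀ (Real.sqrt_pos.2 hpos) (Real.sqrt_le_sqrt ?_)
  calc _ = (a * (t : ℝ) ^ ν) * ((a / b) ^ (1 / ν) * t) := by
        rw [Real.rpow_add_one ht.ne']; ring
    _ ≤ _ := mul_le_mul (mem_items.1 hi).1 hu' (by positivity) (by positivity)

theorem tendsto_eta (hν : 1 < ν) : Tendsto (eta a b ν) atTop (𝓝 0) :=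
  tendsto_const_mul_pnat_cast_rpow_neg _ (by linarith)

/-- The order of the Poisson approximation error. The exponent is `ν + 2 - 3 (ν + 1) / 2 = -(ν - 1)
/ 2`, negative because `ν > 1`. -/
theorem tendsto_card_mul_eta_pow_three (ha : 0 < a) (hab : a < b) (hν : 1 < ν) :
    Tendsto (fun t => ((items a b ν t).card : ℝ) * ((actors a b ν t).card : ℝ) ^ 2 *
      eta a b ν t ^ 3) atTop (𝓝 0) := by
  have hb : 0 < b := ha.trans hab
  have hlim : Tendsto (fun t : ℕ+ => b * ((b / a) ^ (1 / ν)) ^ 2 *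
      (√(a * (a / b) ^ (1 / ν)))⁻¹ ^ 3 * (t : ℝ) ^ (-((ν - 1) / 2))) atTop (𝓝 0) :=
    tendsto_const_mul_pnat_cast_rpow_neg _ (by linarith)
  refine squeeze_zero (fun t => ?_) (fun t => ?_) hlim
  · have := eta_pos (ν := ν) ha hab t; positivity
  · have ht : (0 : ℝ) < t := by exact_mod_cast t.pos
    have h0 := eta_pos (ν := ν) ha hab t
    calc _ ≤ b * (t : ℝ) ^ ν * ((b / a) ^ (1 / ν) * t) ^ 2 * eta a b ν t ^ 3 := by
          gcongr
          exacts [card_items_le ha hab t, card_actors_le ha hab t]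
      _ = b * ((b / a) ^ (1 / ν)) ^ 2 * (√(a * (a / b) ^ (1 / ν)))⁻¹ ^ 3 *
          ((t : ℝ) ^ ν * (t : ℝ) ^ 2 * ((t : ℝ) ^ (-((ν + 1) / 2))) ^ 3) := by
          rw [eta]; ring
      _ = _ := by
          rw [← Real.rpow_natCast (t : ℝ), ← Real.rpow_natCast ((t : ℝ) ^ (-((ν + 1) / 2))),
            ← Real.rpow_mul ht.le, ← Real.rpow_add ht, ← Real.rpow_add ht]
          congr 2; push_cast; ring

/-- This controls both the probability of a second common item and the second moment in the law of
large numbers. The exponent is `ν + 1 + ν - 2 (ν + 1) = -1`. -/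
theorem tendsto_card_mul_eta_pow_four (ha : 0 < a) (hab : a < b) (hν : 1 < ν) :
    Tendsto (fun t => ((items a b ν t).card : ℝ) * ((actors a b ν t).card : ℝ) *
      (((items a b ν t).card : ℝ) + ((actors a b ν t).card : ℝ)) *
      eta a b ν t ^ 4) atTop (𝓝 0) := by
  have hb : 0 < b := ha.trans hab
  set C : ℝ := b * (b / a) ^ (1 / ν) * (b + (b / a) ^ (1 / ν)) *
      (√(a * (a / b) ^ (1 / ν)))⁻¹ ^ 4 with hC
  have hlim : Tendsto (fun t : ℕ+ => C * (t : ℝ) ^ (-1 : ℝ)) atTop (𝓝 0) :=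
    tendsto_const_mul_pnat_cast_rpow_neg _ one_pos
  refine squeeze_zero (fun t => ?_) (fun t => ?_) hlim
  · have := eta_pos (ν := ν) ha hab t; positivity
  · have ht : (0 : ℝ) < t := by exact_mod_cast t.pos
    have ht1 : (1 : ℝ) ≤ t := by exact_mod_cast t.2
    have h0 := eta_pos (ν := ν) ha hab t
    have htν : (t : ℝ) ≤ (t : ℝ) ^ ν := Real.self_le_rpow_of_one_le ht1 hν.le
    have hc2 : ((actors a b ν t).card : ℝ) ≤ (b / a) ^ (1 / ν) * (t : ℝ) ^ ν :=
      (card_actors_le ha hab t).trans (by gcongr)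
    calc _ ≤ b * (t : ℝ) ^ ν * ((b / a) ^ (1 / ν) * t) *
            (b * (t : ℝ) ^ ν + (b / a) ^ (1 / ν) * (t : ℝ) ^ ν) * eta a b ν t ^ 4 := by
          gcongr
          exacts [card_items_le ha hab t, card_actors_le ha hab t, card_items_le ha hab t]
      _ = C * ((t : ℝ) ^ ν * (t : ℝ) ^ (1 : ℝ) * (t : ℝ) ^ ν *
            ((t : ℝ) ^ (-((ν + 1) / 2))) ^ 4) := by
          rw [eta, hC, Real.rpow_one]; ring
      _ = _ := by
          rw [← Real.rpow_natCast ((t : ℝ) ^ (-((ν + 1) / 2))),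
            ← Real.rpow_mul ht.le, ← Real.rpow_add ht, ← Real.rpow_add ht, ← Real.rpow_add ht]
          congr 2; push_cast; ring

end

/-! ### Complex estimates and the Poisson approximation -/

theorem norm_prod_sub_prod_le_sum {ι : Type*} (s : Finset ι) (x y : ι → ℂ)
    (hx : ∀ i ∈ s, ‖x i‖ ≤ 1) (hy : ∀ i ∈ s, ‖y i‖ ≤ 1) :
    ‖∏ i ∈ s, x i - ∏ i ∈ s, y i‖ ≤ ∑ i ∈ s, ‖x i - y i‖ := by
  classical
  induction s using Finset.induction_on with
  | empty => simp
  | insert j s hj ih =>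
    rw [Finset.prod_insert hj, Finset.prod_insert hj, Finset.sum_insert hj]
    have hxs : ‖∏ i ∈ s, x i‖ ≤ 1 := by
      rw [norm_prod]
      exact Finset.prod_le_one (fun _ _ => norm_nonneg _)
        fun i hi => hx i (Finset.mem_insert_of_mem hi)
    have ih := ih (fun i hi => hx i (Finset.mem_insert_of_mem hi))
      fun i hi => hy i (Finset.mem_insert_of_mem hi)
    have hyj := hy j (Finset.mem_insert_self j s)
    calc _ = ‖(x j - y j) * ∏ i ∈ s, x i + y j * (∏ i ∈ s, x i - ∏ i ∈ s, y i)‖ := by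
          congr 1; ring
      _ ≤ ‖x j - y j‖ * ‖∏ i ∈ s, x i‖ + ‖y j‖ * ‖∏ i ∈ s, x i - ∏ i ∈ s, y i‖ := by
          rw [← norm_mul, ← norm_mul]; exact norm_add_le _ _
      _ ≤ ‖x j - y j‖ * 1 + 1 * ∑ i ∈ s, ‖x i - y i‖ := by gcongr
      _ = _ := by ring

theorem norm_prod_one_add_sub_le {ι : Type*} (s : Finset ι) (w : ι → ℂ)
    (hw : ∀ i ∈ s, ‖1 + w i‖ ≤ 1) :
    ‖∏ i ∈ s, (1 + w i) - 1 - ∑ i ∈ s, w i‖ ≤ (∑ i ∈ s, ‖w i‖) ^ 2 := by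
  classical
  induction s using Finset.induction_on with
  | empty => simp
  | insert j s hj ih =>
    have hws : ∀ i ∈ s, ‖1 + w i‖ ≤ 1 := fun i hi => hw i (Finset.mem_insert_of_mem hi)
    have ih := ih hws
    have h1 : ‖∏ i ∈ s, (1 + w i) - 1‖ ≤ ∑ i ∈ s, ‖w i‖ := by
      simpa using norm_prod_sub_prod_le_sum s (fun i => 1 + w i) (fun _ => 1) hws (by simp)
    rw [Finset.prod_insert hj, Finset.sum_insert hj, Finset.sum_insert hj]
    have h0 : 0 ≤ ∑ i ∈ s, ‖w i‖ := Finset.sum_nonneg fun _ _ => norm_nonneg _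
    calc _ = ‖w j * (∏ i ∈ s, (1 + w i) - 1) + (∏ i ∈ s, (1 + w i) - 1 - ∑ i ∈ s, w i)‖ := by
          congr 1; ring
      _ ≤ ‖w j‖ * ‖∏ i ∈ s, (1 + w i) - 1‖ + ‖∏ i ∈ s, (1 + w i) - 1 - ∑ i ∈ s, w i‖ := by
          rw [← norm_mul]; exact norm_add_le _ _
      _ ≤ ‖w j‖ * ∑ i ∈ s, ‖w i‖ + (∑ i ∈ s, ‖w i‖) ^ 2 := by gcongr
      _ ≤ _ := by nlinarith [norm_nonneg (w j), mul_nonneg (norm_nonneg (w j)) h0]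

theorem norm_exp_le_one_of_re_nonpos {w : ℂ} (hw : w.re ≤ 0) : ‖Complex.exp w‖ ≤ 1 := by
  rw [Complex.norm_exp]; exact Real.exp_le_one_iff.2 hw

/-- Near `0` this is Taylor's estimate; for `‖w‖ > 1` the trivial bound `2 + ‖w‖` is at most `3 *
‖w‖ ^ 2`. -/
theorem norm_exp_sub_one_sub_le {w : ℂ} (hw : w.re ≤ 0) :
    ‖Complex.exp w - 1 - w‖ ≤ 3 * ‖w‖ ^ 2 := by
  rcases le_or_gt ‖w‖ 1 with h | h
  · have := Complex.norm_exp_sub_one_sub_id_le h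
    nlinarith [sq_nonneg ‖w‖]
  · have h1 : ‖Complex.exp w - 1 - w‖ ≤ ‖Complex.exp w‖ + ‖(1 : ℂ)‖ + ‖w‖ :=
      (norm_sub_le _ _).trans (by gcongr; exact norm_sub_le _ _)
    have h2 := norm_exp_le_one_of_re_nonpos hw
    rw [norm_one] at h1
    nlinarith

theorem norm_exp_sub_exp_le {w v : ℂ} (hw : w.re ≤ 0) (hv : v.re ≤ 0) :
    ‖Complex.exp w - Complex.exp v‖ ≤ ‖w - v‖ := by
  have h := Convex.norm_image_sub_le_of_norm_deriv_le (f := Complex.exp) (C := 1)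
    (s := {x : ℂ | x.re ≤ 0}) (x := v) (y := w)
    (fun x _ => Complex.differentiable_exp.differentiableAt)
    (fun x hx => by rw [Complex.deriv_exp]; exact norm_exp_le_one_of_re_nonpos hx)
    (convex_halfSpace_re_le 0) hv hw
  simpa using h

theorem norm_one_add_sub_one_mul_le {z : ℂ} (hz : ‖z‖ ≤ 1) {q : ℝ} (h0 : 0 ≤ q) (h1 : q ≤ 1) :
    ‖1 + (z - 1) * q‖ ≤ 1 := by
  calc _ = ‖((1 - q : ℝ) : ℂ) + (q : ℂ) * z‖ := by congr 1; push_cast; ring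
    _ ≤ ‖((1 - q : ℝ) : ℂ)‖ + ‖(q : ℂ)‖ * ‖z‖ := by rw [← norm_mul]; exact norm_add_le _ _
    _ ≤ (1 - q) + q * 1 := by
        rw [Complex.norm_of_nonneg (by linarith), Complex.norm_of_nonneg h0]; gcongr
    _ = 1 := by ring

theorem sub_one_mul_re_nonpos {z : ℂ} (hz : ‖z‖ ≤ 1) {q : ℝ} (h0 : 0 ≤ q) :
    ((z - 1) * (q : ℂ)).re ≤ 0 := by
  rw [Complex.re_mul_ofReal, Complex.sub_re, Complex.one_re]
  exact mul_nonpos_of_nonpos_of_nonneg (by linarith [Complex.re_le_norm z]) h0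

theorem norm_sub_one_le_two {z : ℂ} (hz : ‖z‖ ≤ 1) : ‖z - 1‖ ≤ 2 :=
  (norm_sub_le _ _).trans (by rw [norm_one]; linarith)

/-- The generating function of a compound sum of independent Bernoulli variables. -/
noncomputable def compoundGen {ι κ : Type*} (I : Finset ι) (J : Finset κ) (z : ℂ)
    (p : ι → ℂ) (q : ι → κ → ℂ) : ℂ :=
  ∏ i ∈ I, (1 + p i * (∏ u ∈ J, (1 + (z - 1) * q i u) - 1))

/-- The exponential also factors over the items. With `σ = ∑ u, q i u`, each pair of factors agrees
with `1 + (z - 1) p σ` up to second order. All factors lie in the unit disc, so the errors simply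
add. -/
theorem norm_compoundGen_sub_exp_le {ι κ : Type*} (I : Finset ι) (J : Finset κ) {z : ℂ}
    (hz : ‖z‖ ≤ 1) (p : ι → ℝ) (q : ι → κ → ℝ) (hp0 : ∀ i ∈ I, 0 ≤ p i) (hp1 : ∀ i ∈ I, p i ≤ 1)
    (hq0 : ∀ i ∈ I, ∀ u ∈ J, 0 ≤ q i u) (hq1 : ∀ i ∈ I, ∀ u ∈ J, q i u ≤ 1) :
    ‖compoundGen I J z (fun i => p i) (fun i u => q i u) -
      Complex.exp ((z - 1) * (∑ i ∈ I, ∑ u ∈ J, p i * q i u : ℝ))‖ ≤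
      ∑ i ∈ I, 16 * (p i * (∑ u ∈ J, q i u) ^ 2) := by
  have hz2 := norm_sub_one_le_two hz
  have e : Complex.exp ((z - 1) * (∑ i ∈ I, ∑ u ∈ J, p i * q i u : ℝ)) =
      ∏ i ∈ I, Complex.exp ((z - 1) * ((p i * ∑ u ∈ J, q i u : ℝ) : ℂ)) := by
    rw [← Complex.exp_sum, ← Finset.mul_sum]
    congr 2
    push_cast
    simp only [Finset.mul_sum]
  have hσ : ∀ i ∈ I, 0 ≤ ∑ u ∈ J, q i u := fun i hi => Finset.sum_nonneg (hq0 i hi)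
  have hin : ∀ i ∈ I, ‖∏ u ∈ J, (1 + (z - 1) * (q i u : ℂ))‖ ≤ 1 := fun i hi => by
    rw [norm_prod]
    exact Finset.prod_le_one (fun _ _ => norm_nonneg _)
      fun u hu => norm_one_add_sub_one_mul_le hz (hq0 i hi u hu) (hq1 i hi u hu)
  rw [e, compoundGen]
  refine (norm_prod_sub_prod_le_sum _ _ _ (fun i hi => ?_) fun i hi => ?_).trans
    (Finset.sum_le_sum fun i hi => ?_)
  · rw [mul_comm]
    exact norm_one_add_sub_one_mul_le (hin i hi) (hp0 i hi) (hp1 i hi)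
  · exact norm_exp_le_one_of_re_nonpos
      (sub_one_mul_re_nonpos hz (mul_nonneg (hp0 i hi) (hσ i hi)))
  · set P := ∏ u ∈ J, (1 + (z - 1) * (q i u : ℂ)) with hP
    set σ := ∑ u ∈ J, q i u with hσdef
    set w : ℂ := (z - 1) * ((p i * σ : ℝ) : ℂ) with hw
    have hp := hp0 i hi
    have hs := hσ i hi
    have h1 : ‖P - 1 - (z - 1) * σ‖ ≤ (2 * σ) ^ 2 := by
      have h := norm_prod_one_add_sub_le J (fun u => (z - 1) * (q i u : ℂ))
        fun u hu => norm_one_add_sub_one_mul_le hz (hq0 i hi u hu) (hq1 i hi u hu)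
      rw [← Finset.mul_sum, ← Complex.ofReal_sum] at h
      refine h.trans ?_
      have h3 : ∑ u ∈ J, ‖(z - 1) * (q i u : ℂ)‖ ≤ 2 * σ := by
        rw [hσdef, Finset.mul_sum]
        refine Finset.sum_le_sum fun u hu => ?_
        rw [norm_mul, Complex.norm_of_nonneg (hq0 i hi u hu)]
        exact mul_le_mul_of_nonneg_right hz2 (hq0 i hi u hu)
      exact pow_le_pow_left₀ (Finset.sum_nonneg fun _ _ => norm_nonneg _) h3 2
    have h2 : ‖Complex.exp w - 1 - w‖ ≤ 3 * (2 * (p i * σ)) ^ 2 := by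
      refine (norm_exp_sub_one_sub_le (sub_one_mul_re_nonpos hz (mul_nonneg hp hs))).trans ?_
      have : ‖w‖ ≤ 2 * (p i * σ) := by
        rw [hw, norm_mul, Complex.norm_of_nonneg (mul_nonneg hp hs)]
        exact mul_le_mul_of_nonneg_right hz2 (mul_nonneg hp hs)
      gcongr
    calc _ = ‖(p i : ℂ) * (P - 1 - (z - 1) * σ) - (Complex.exp w - 1 - w)‖ := by
          congr 1; rw [hw]; push_cast; ring
      _ ≤ p i * (2 * σ) ^ 2 + 3 * (2 * (p i * σ)) ^ 2 := by
          refine (norm_sub_le _ _).trans (add_le_add ?_ h2)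
          rw [norm_mul, Complex.norm_of_nonneg hp]
          exact mul_le_mul_of_nonneg_left h1 hp
      -- The constant is `16 = 4 + 12`, after `p i ^ 2 ≤ p i`.
      _ ≤ _ := by
          have : p i * (p i * σ ^ 2) ≤ 1 * (p i * σ ^ 2) :=
            mul_le_mul_of_nonneg_right (hp1 i hi) (by positivity)
          nlinarith

/-! ### Means of multi-affine functions of events -/

section MultiAffine

variable {ι : Type*}

/-- The functions of the coordinates in `S` that are affine in each of them. -/
def multiAffine (S : Finset ι) : Submodule ℂ ((ι → ℂ) → ℂ) :=
  Submodule.span ℂ ((fun (A : Finset ι) (x : ι → ℂ) => ∏ e ∈ A, x e) '' {A | A ⊆ S})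

theorem monomial_mem_multiAffine {A S : Finset ι} (h : A ⊆ S) :
    (fun x : ι → ℂ => ∏ e ∈ A, x e) ∈ multiAffine S :=
  Submodule.subset_span ⟨A, h, rfl⟩

theorem one_mem_multiAffine (S : Finset ι) : (1 : (ι → ℂ) → ℂ) ∈ multiAffine S := by
  simpa using! monomial_mem_multiAffine (Finset.empty_subset S)

theorem coord_mem_multiAffine {S : Finset ι} {e : ι} (he : e ∈ S) :
    (fun x : ι → ℂ => x e) ∈ multiAffine S := by
  simpa using monomial_mem_multiAffine (Finset.singleton_subset_iff.2 he)

theorem mul_mem_multiAffine [DecidableEq ι] {S T : Finset ι} (hST : Disjoint S T)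
    {F G : (ι → ℂ) → ℂ} (hF : F ∈ multiAffine S) (hG : G ∈ multiAffine T) :
    F * G ∈ multiAffine (S ∪ T) := by
  have h := Submodule.mul_mem_mul hF hG
  rw [multiAffine, multiAffine, Submodule.span_mul_span] at h
  refine Submodule.span_le.2 ?_ h
  rintro _ ⟨_, ⟨A, hA, rfl⟩, _, ⟨B, hB, rfl⟩, rfl⟩
  have : (fun x : ι → ℂ => ∏ e ∈ A ∪ B, x e) ∈ multiAffine (S ∪ T) :=
    monomial_mem_multiAffine (Finset.union_subset_union hA hB)
  refine (congrArg (· ∈ multiAffine (S ∪ T)) (funext fun x => ?_)).mpr this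
  exact (Finset.prod_union (Finset.disjoint_of_subset_left hA
    (Finset.disjoint_of_subset_right hB hST))).symm

theorem prod_mem_multiAffine [DecidableEq ι] {κ : Type*} (I : Finset κ) (S : κ → Finset ι)
    (hS : (I : Set κ).PairwiseDisjoint S) (F : κ → (ι → ℂ) → ℂ)
    (hF : ∀ i ∈ I, F i ∈ multiAffine (S i)) : ∏ i ∈ I, F i ∈ multiAffine (I.biUnion S) := by
  classical
  induction I using Finset.induction_on with
  | empty => simpa using one_mem_multiAffine _
  | insert j I hj ih =>
    rw [Finset.prod_insert hj, Finset.biUnion_insert]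
    refine mul_mem_multiAffine ?_ (hF j (Finset.mem_insert_self j I))
      (ih (hS.subset (by simp)) fun i hi => hF i (Finset.mem_insert_of_mem hi))
    rw [Finset.disjoint_biUnion_right]
    intro i hi
    exact hS (by simp) (by simp [hi]) (by rintro rfl; exact hj hi)

/-- Different items use disjoint sets of edges, and `t ∉ J` keeps the edge `(i, t)` apart from the
edges `(i, u)`; no coordinate is ever squared. -/
theorem compoundGen_mem_multiAffine {κ κ' : Type*} [DecidableEq κ] [DecidableEq κ']
    (I : Finset κ) (J : Finset κ') {t : κ'} (ht : t ∉ J) (z : ℂ) :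
    (fun x : κ × κ' → ℂ => compoundGen I J z (fun i => x (i, t)) fun i u => x (i, u)) ∈
      multiAffine (I ×ˢ insert t J) := by
  have hprod : ∀ i, (∏ u ∈ J, (1 + (z - 1) • fun x : κ × κ' → ℂ => x (i, u))) ∈
      multiAffine (J.biUnion fun u => {(i, u)}) := fun i => by
    refine prod_mem_multiAffine J _ (fun u _ v _ huv => ?_) _ fun u _ => ?_
    · simpa using huv
    · exact Submodule.add_mem _ (one_mem_multiAffine _)
        (Submodule.smul_mem _ _ (coord_mem_multiAffine (by simp)))
  have hfac : ∀ i, (1 + (fun x : κ × κ' → ℂ => x (i, t)) *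
      (∏ u ∈ J, (1 + (z - 1) • fun x : κ × κ' → ℂ => x (i, u)) - 1)) ∈
      multiAffine ({(i, t)} ∪ J.biUnion fun u => {(i, u)}) := fun i => by
    refine Submodule.add_mem _ (one_mem_multiAffine _) (mul_mem_multiAffine ?_
      (coord_mem_multiAffine (by simp)) (Submodule.sub_mem _ (hprod i) (one_mem_multiAffine _)))
    simpa using ht
  have h := prod_mem_multiAffine I _ (fun i _ j _ hij => ?_) _ fun i _ => hfac i
  · convert h using 1
    · congr 1
      ext ⟨i, u⟩
      simp only [Finset.mem_product, Finset.mem_insert, Finset.mem_biUnion, Finset.mem_union,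
        Finset.mem_singleton, Prod.mk.injEq]
      grind
    · funext x
      simp [compoundGen, Finset.prod_apply]
  · rw [Function.onFun, Finset.disjoint_left]
    simp only [Finset.mem_union, Finset.mem_singleton, Finset.mem_biUnion]
    grind

variable {Ω : Type*} {mΩ : MeasurableSpace Ω} (μ : Measure Ω) [IsProbabilityMeasure μ]

/-- Multi-affine functions of events have the same mean as the same functions of the (random)
probabilities of the events, if that is true of the monomials. -/
theorem integral_multiAffine {E : ι → Set Ω} (hE : ∀ e, MeasurableSet (E e)) {P : ι → Ω → ℝ}
    (hP : ∀ e, Measurable (P e)) (hP0 : ∀ e ω, 0 ≤ P e ω) (hP1 : ∀ e ω, P e ω ≤ 1)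
    (hmom : ∀ S : Finset ι, μ.real (⋂ e ∈ S, E e) = ∫ ω, ∏ e ∈ S, P e ω ∂μ)
    {S : Finset ι} {F : (ι → ℂ) → ℂ} (hF : F ∈ multiAffine S) :
    Integrable (fun ω => F fun e => (E e).indicator 1 ω) μ ∧
    Integrable (fun ω => F fun e => (P e ω : ℂ)) μ ∧
    ∫ ω, F (fun e => (E e).indicator 1 ω) ∂μ = ∫ ω, F (fun e => (P e ω : ℂ)) ∂μ := by
  induction hF using Submodule.span_induction with
  | mem F hF =>
    obtain ⟨A, -, rfl⟩ := hF
    have e1 : (fun ω => ∏ e ∈ A, (E e).indicator (1 : Ω → ℂ) ω) =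
        (⋂ e ∈ A, E e).indicator 1 := by
      funext ω
      by_cases h : ∀ e ∈ A, ω ∈ E e
      · rw [Set.indicator_of_mem (by simpa using h)]
        exact Finset.prod_eq_one fun e he => Set.indicator_of_mem (h e he) _
      · rw [Set.indicator_of_notMem (by simpa using h)]
        push Not at h
        obtain ⟨e, he, hω⟩ := h
        exact Finset.prod_eq_zero he (Set.indicator_of_notMem hω _)
    have hms : MeasurableSet (⋂ e ∈ A, E e) := A.measurableSet_biInter fun e _ => hE e
    have e2 : (fun ω => ∏ e ∈ A, (P e ω : ℂ)) = fun ω => ((∏ e ∈ A, P e ω : ℝ) : ℂ) := by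
      funext ω; push_cast; rfl
    refine ⟨?_, ?_, ?_⟩
    · simp only [e1]
      exact (integrable_const (1 : ℂ)).indicator hms
    · simp only [e2]
      refine Integrable.of_bound (Measurable.aestronglyMeasurable (by fun_prop)) 1
        (ae_of_all _ fun ω => ?_)
      rw [Complex.norm_of_nonneg (Finset.prod_nonneg fun e _ => hP0 e ω)]
      exact Finset.prod_le_one (fun e _ => hP0 e ω) fun e _ => hP1 e ω
    · simp only [e1, e2]
      rw [integral_complex_ofReal, ← hmom, integral_indicator hms]
      simp
  | zero => simp
  | add F G _ _ hF hG =>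
    refine ⟨hF.1.add hG.1, hF.2.1.add hG.2.1, ?_⟩
    simp only [Pi.add_apply]
    rw [integral_add hF.1 hG.1, integral_add hF.2.1 hG.2.1, hF.2.2, hG.2.2]
  | smul c F _ hF =>
    refine ⟨hF.1.smul c, hF.2.1.smul c, ?_⟩
    simp only [Pi.smul_apply]
    rw [integral_smul, integral_smul, hF.2.2]

end MultiAffine

/-! ### A second moment bound for weighted sums of `X_i ^ 2 * Y_u` -/

section LawOfLargeNumbers

variable {Ω : Type*} {mΩ : MeasurableSpace Ω} (μ : Measure Ω)

variable {X Y : ℕ+ → Ω → ℝ}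

theorem integral_sq_mul (hXm : ∀ i, Measurable (X i)) (hYm : ∀ j, Measurable (Y j))
    (hindep : iIndepFun (Sum.elim X Y) μ)
    (hXid : ∀ i, IdentDistrib (X i) (X 1) μ μ) (hYid : ∀ j, IdentDistrib (Y j) (Y 1) μ μ)
    (i u : ℕ+) :
    ∫ ω, X i ω ^ 2 * Y u ω ∂μ = (∫ ω, X 1 ω ^ 2 ∂μ) * ∫ ω, Y 1 ω ∂μ := by
  have h : IndepFun (X i) (Y u) μ := hindep.indepFun (i := .inl i) (j := .inr u) (by simp)
  have h' : IndepFun (fun ω => X i ω ^ 2) (Y u) μ :=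
    h.comp (φ := fun x => x ^ 2) (ψ := id) (by fun_prop) measurable_id
  have e : ∫ ω, X i ω ^ 2 ∂μ = ∫ ω, X 1 ω ^ 2 ∂μ :=
    ((hXid i).comp (u := fun x => x ^ 2) (by fun_prop)).integral_eq
  rw [h'.integral_fun_mul_eq_mul_integral (by fun_prop) (by fun_prop), e, (hYid u).integral_eq]

variable [IsProbabilityMeasure μ]

theorem sq_integral_abs_le {f : Ω → ℝ} (hf : MemLp f 2 μ) :
    (∫ ω, |f ω| ∂μ) ^ 2 ≤ ∫ ω, f ω ^ 2 ∂μ := by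
  have h := variance_eq_sub hf.abs
  have h0 := variance_nonneg |f| μ
  simp only [Pi.abs_apply, Pi.pow_apply, sq_abs] at h
  linarith

open Classical in
/-- A second moment bound for a weighted sum of bounded variables, most pairs of which are
orthogonal. -/
theorem sq_integral_abs_sum_le {κ : Type*} (P : Finset κ) {g : κ → Ω → ℝ}
    (hg : ∀ k, Measurable (g k)) {B : ℝ} (hB : ∀ k ω, |g k ω| ≤ B) (R : κ → κ → Prop)
    (hR : ∀ k l, ¬ R k l → ∫ ω, g k ω * g l ω ∂μ = 0) {c : κ → ℝ} {δ : ℝ}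
    (hc : ∀ k ∈ P, |c k| ≤ δ) {D : ℝ}
    (hD : ∀ k ∈ P, (({l ∈ P | R k l} : Finset κ).card : ℝ) ≤ D) :
    (∫ ω, |∑ k ∈ P, c k * g k ω| ∂μ) ^ 2 ≤ P.card * D * (δ * B) ^ 2 := by
  have hint : ∀ k l, Integrable (fun ω => g k ω * g l ω) μ := fun k l =>
    Integrable.of_bound (by fun_prop) (B * B) (ae_of_all _ fun ω => by
      rw [Real.norm_eq_abs, abs_mul]
      exact mul_le_mul (hB k ω) (hB l ω) (abs_nonneg _) ((abs_nonneg _).trans (hB k ω)))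
  have hmem : MemLp (fun ω => ∑ k ∈ P, c k * g k ω) 2 μ := by
    refine memLp_finsetSum _ fun k _ => MemLp.const_mul ?_ _
    exact MemLp.of_bound (hg k).aestronglyMeasurable B (ae_of_all _ fun ω => hB k ω)
  refine (sq_integral_abs_le μ hmem).trans ?_
  have e : ∫ ω, (∑ k ∈ P, c k * g k ω) ^ 2 ∂μ =
      ∑ k ∈ P, ∑ l ∈ P, c k * c l * ∫ ω, g k ω * g l ω ∂μ := by
    simp_rw [sq, Finset.sum_mul_sum]
    have e1 : ∀ k l ω, c k * g k ω * (c l * g l ω) = c k * c l * (g k ω * g l ω) :=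
      fun k l ω => by ring
    simp_rw [e1]
    rw [integral_finsetSum _ fun k _ => integrable_finsetSum _ fun l _ => (hint k l).const_mul _]
    refine Finset.sum_congr rfl fun k _ => ?_
    rw [integral_finsetSum _ fun l _ => (hint k l).const_mul _]
    exact Finset.sum_congr rfl fun l _ => integral_const_mul _ _
  rw [e, mul_assoc, ← nsmul_eq_mul]
  refine Finset.sum_le_card_nsmul _ _ _ fun k hk => ?_
  calc _ ≤ ∑ l ∈ P, if R k l then (δ * B) ^ 2 else 0 := by
        refine Finset.sum_le_sum fun l hl => ?_
        split_ifs with h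
        · refine (le_abs_self _).trans ?_
          rw [abs_mul, abs_mul]
          have h1 : |∫ ω, g k ω * g l ω ∂μ| ≤ B * B := by
            have := norm_integral_le_of_norm_le_const (μ := μ) (f := fun ω => g k ω * g l ω)
              (C := B * B) (ae_of_all _ fun ω => by
                rw [Real.norm_eq_abs, abs_mul]
                exact mul_le_mul (hB k ω) (hB l ω) (abs_nonneg _)
                  ((abs_nonneg _).trans (hB k ω)))
            simpa using this
          calc _ ≤ δ * δ * (B * B) := by
                have := hc k hk
                have := hc l hl
                have : 0 ≤ δ := (abs_nonneg _).trans (hc k hk)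
                gcongr
            _ = _ := by ring
        · rw [hR k l h, mul_zero]
    _ = (({l ∈ P | R k l} : Finset κ).card : ℝ) * (δ * B) ^ 2 := by
        rw [← Finset.sum_filter, Finset.sum_const, nsmul_eq_mul]
    _ ≤ _ := mul_le_mul_of_nonneg_right (hD k hk) (sq_nonneg _)

/-- Centred terms whose pairs share neither the item nor the actor are independent, hence
orthogonal. A given pair meets at most `I.card + J.card` others. -/
theorem sq_integral_abs_sum_sq_mul_sub_le (hXm : ∀ i, Measurable (X i))
    (hYm : ∀ j, Measurable (Y j)) (hindep : iIndepFun (Sum.elim X Y) μ)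
    (hXid : ∀ i, IdentDistrib (X i) (X 1) μ μ) (hYid : ∀ j, IdentDistrib (Y j) (Y 1) μ μ)
    {M : ℝ} (hX : ∀ i ω, |X i ω| ≤ M) (hY : ∀ i ω, |Y i ω| ≤ M) (I J : Finset ℕ+)
    (c : ℕ+ × ℕ+ → ℝ) {δ : ℝ} (hc : ∀ k ∈ I ×ˢ J, |c k| ≤ δ) :
    (∫ ω, |∑ k ∈ I ×ˢ J, c k * (X k.1 ω ^ 2 * Y k.2 ω -
      (∫ ω, X 1 ω ^ 2 ∂μ) * ∫ ω, Y 1 ω ∂μ)| ∂μ) ^ 2 ≤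
      (I.card * J.card : ℝ) * (I.card + J.card) * (δ * (2 * M ^ 3)) ^ 2 := by
  set m : ℝ := (∫ ω, X 1 ω ^ 2 ∂μ) * ∫ ω, Y 1 ω ∂μ with hm
  have hb : ∀ i u ω, |X i ω ^ 2 * Y u ω| ≤ M ^ 3 := fun i u ω => by
    rw [abs_mul, abs_pow]
    have := hX i ω
    have := hY u ω
    have : 0 ≤ M := (abs_nonneg _).trans (hX i ω)
    calc _ ≤ M ^ 2 * M := by gcongr
      _ = _ := by ring
  have hmb : |m| ≤ M ^ 3 := by
    rw [hm, ← integral_sq_mul μ hXm hYm hindep hXid hYid 1 1]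
    simpa using norm_integral_le_of_norm_le_const (μ := μ) (f := fun ω => X 1 ω ^ 2 * Y 1 ω)
      (C := M ^ 3) (ae_of_all _ fun ω => hb 1 1 ω)
  have hint : ∀ i u, Integrable (fun ω => X i ω ^ 2 * Y u ω) μ := fun i u =>
    Integrable.of_bound (by fun_prop) (M ^ 3) (ae_of_all _ fun ω => hb i u ω)
  have hcen : ∀ i u, ∫ ω, (X i ω ^ 2 * Y u ω - m) ∂μ = 0 := fun i u => by
    rw [integral_sub (hint i u) (integrable_const m),
      integral_sq_mul μ hXm hYm hindep hXid hYid]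
    simp [hm]
  have h := sq_integral_abs_sum_le μ (I ×ˢ J)
    (g := fun k ω => X k.1 ω ^ 2 * Y k.2 ω - m) (fun k => by fun_prop) (B := 2 * M ^ 3)
    (fun k ω => (abs_sub _ _).trans (by linarith [hb k.1 k.2 ω]))
    (fun k l => k.1 = l.1 ∨ k.2 = l.2) (fun k l hkl => ?_) hc (D := I.card + J.card)
    (fun k _ => ?_)
  · rwa [Finset.card_product, Nat.cast_mul] at h
  · push Not at hkl
    have hi := hindep.indepFun_prodMk_prodMk (by rintro (i | i); exacts [hXm i, hYm i])
      (.inl k.1) (.inr k.2) (.inl l.1) (.inr l.2) (by simpa using hkl.1) (by simp) (by simp)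
      (by simpa using hkl.2)
    have hi' := hi.comp (φ := fun x : ℝ × ℝ => x.1 ^ 2 * x.2 - m)
      (ψ := fun x : ℝ × ℝ => x.1 ^ 2 * x.2 - m) (by fun_prop) (by fun_prop)
    have := hi'.integral_fun_mul_eq_mul_integral
      (Measurable.aestronglyMeasurable (by simp only [Sum.elim_inl, Sum.elim_inr]; fun_prop))
      (Measurable.aestronglyMeasurable (by simp only [Sum.elim_inl, Sum.elim_inr]; fun_prop))
    simp only [Function.comp_apply, Sum.elim_inl, Sum.elim_inr] at this
    rw [this, hcen, zero_mul]
  · classical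
    have hsub : ({l ∈ I ×ˢ J | k.1 = l.1 ∨ k.2 = l.2} : Finset (ℕ+ × ℕ+)) ⊆
        {k.1} ×ˢ J ∪ I ×ˢ {k.2} := by
      intro l
      simp only [Finset.mem_filter, Finset.mem_product, Finset.mem_union, Finset.mem_singleton]
      grind
    have := (Finset.card_le_card hsub).trans (Finset.card_union_le _ _)
    simp only [Finset.card_product, Finset.card_singleton, one_mul, mul_one] at this
    have h2 : (({l ∈ I ×ˢ J | k.1 = l.1 ∨ k.2 = l.2} : Finset (ℕ+ × ℕ+)).card : ℝ) ≤
        J.card + I.card := by exact_mod_cast this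
    convert h2.trans_eq (add_comm _ _)

end LawOfLargeNumbers

/-! ### Elementary bounds for the edge probabilities -/

section EdgeProb

variable {a b ν : ℝ} {i u : ℕ+} {x y : ℝ}

theorem edgeProb_of_inBand (h : InBand a b ν i u) :
    edgeProb a b (fun t => (t : ℝ) ^ ν) i u x y = min 1 (x * y / √((i : ℝ) * u)) := by
  rw [edgeProb]; exact if_pos h

theorem edgeProb_of_not_inBand (h : ¬ InBand a b ν i u) :
    edgeProb a b (fun t => (t : ℝ) ^ ν) i u x y = 0 := by
  rw [edgeProb]; exact if_neg h

theorem edgeProb_le_one {τ : ℕ+ → ℝ} : edgeProb a b τ i u x y ≤ 1 := by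
  rw [edgeProb]; split_ifs
  exacts [min_le_left _ _, zero_le_one]

theorem edgeProb_nonneg {τ : ℕ+ → ℝ} (hx : 0 ≤ x) (hy : 0 ≤ y) : 0 ≤ edgeProb a b τ i u x y := by
  rw [edgeProb]; split_ifs
  exacts [le_min zero_le_one (by positivity), le_rfl]

theorem edgeProb_le {τ : ℕ+ → ℝ} (hx : 0 ≤ x) (hy : 0 ≤ y) :
    edgeProb a b τ i u x y ≤ x * y * (√((i : ℝ) * u))⁻¹ := by
  rw [edgeProb]; split_ifs
  exacts [min_le_right _ _, by positivity]

theorem measurable_edgeProb {τ : ℕ+ → ℝ} (i u : ℕ+) :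
    Measurable (fun p : ℝ × ℝ => edgeProb a b τ i u p.1 p.2) := by
  unfold edgeProb
  split_ifs
  · fun_prop
  · fun_prop

end EdgeProb

/-! ### The degree and the paths of length two -/

section Degree

variable {Ω : Type*} {a b ν : ℝ} {H : ℕ+ → ℕ+ → Set Ω} {ω : Ω}

open Classical in
/-- The pairs of an item and an actor that form a path of length two from `v_t`. -/
noncomputable def paths (a b ν : ℝ) (H : ℕ+ → ℕ+ → Set Ω) (t : ℕ+) (ω : Ω) :
    Finset (ℕ+ × ℕ+) :=
  {k ∈ items a b ν t ×ˢ actors a b ν t | ω ∈ H k.1 t ∧ ω ∈ H k.1 k.2}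

theorem neighborSet_eq_image_paths (ha : 0 < a) (hab : a < b) (hν : 1 < ν)
    (hω : ∀ i u, ω ∈ H i u → InBand a b ν i u) (t : ℕ+) :
    (intersectionGraph H ω).neighborSet t = (paths a b ν H t ω).image Prod.snd := by
  ext u
  simp only [SimpleGraph.mem_neighborSet, Finset.coe_image, Set.mem_image, Finset.mem_coe, paths,
    Finset.mem_filter, Finset.mem_product, Prod.exists, exists_eq_right, intersectionGraph]
  constructor
  · rintro ⟨htu, i, hit, hiu⟩
    exact ⟨i, ⟨mem_items.2 (hω i t hit),
      mem_actors ha hab hν htu.symm (hω i t hit) (hω i u hiu)⟩, hit, hiu⟩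
  · rintro ⟨i, ⟨-, hu⟩, hit, hiu⟩
    exact ⟨(Finset.ne_of_mem_erase hu).symm, i, hit, hiu⟩

theorem degree_eq_card_image (ha : 0 < a) (hab : a < b) (hν : 1 < ν)
    (hω : ∀ i u, ω ∈ H i u → InBand a b ν i u) (t : ℕ+) :
    degree H t ω = ((paths a b ν H t ω).image Prod.snd).card := by
  rw [degree, neighborSet_eq_image_paths ha hab hν hω, Set.ncard_coe_finset]

/-- If no actor shares two items with `v_t`, a path is determined by its endpoint. -/
theorem degree_eq_card_paths (ha : 0 < a) (hab : a < b) (hν : 1 < ν)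
    (hω : ∀ i u, ω ∈ H i u → InBand a b ν i u) {t : ℕ+}
    (h : ∀ u ∈ actors a b ν t, ∀ i ∈ items a b ν t, ∀ i' ∈ items a b ν t, i ≠ i' →
      ω ∉ H i t ∩ H i u ∩ (H i' t ∩ H i' u)) :
    degree H t ω = (paths a b ν H t ω).card := by
  rw [degree_eq_card_image ha hab hν hω]
  refine Finset.card_image_of_injOn ?_
  rintro ⟨i, u⟩ hi ⟨i', u'⟩ hi' (rfl : u = u')
  simp only [paths, Finset.coe_filter, Finset.mem_product, Set.mem_ofPred_eq] at hi hi'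
  by_contra hne
  exact h u hi.1.2 i hi.1.1 i' hi'.1.1 (fun e => hne (by rw [e])) ⟨hi.2, hi'.2⟩

/-- An item not adjacent to `v_t` contributes the factor `1`; an adjacent one contributes `z` once
for each path through it. -/
theorem compoundGen_indicator (t : ℕ+) (z : ℂ) :
    compoundGen (items a b ν t) (actors a b ν t) z (fun i => (H i t).indicator 1 ω)
      (fun i u => (H i u).indicator 1 ω) = z ^ (paths a b ν H t ω).card := by
  classical
  rw [paths, ← Finset.prod_const, Finset.prod_filter, Finset.prod_product, compoundGen]
  refine Finset.prod_congr rfl fun i _ => ?_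
  by_cases hi : ω ∈ H i t
  · simp only [hi, Set.indicator_of_mem, Pi.one_apply, one_mul, add_sub_cancel, true_and]
    refine Finset.prod_congr rfl fun u _ => ?_
    by_cases hu : ω ∈ H i u <;> simp [hu]
  · simp [hi]

end Degree

/-! ### Joint edge probabilities and measurability -/

section Moments

variable {Ω : Type*} {mΩ : MeasurableSpace Ω} {μ : Measure Ω}
  {a b ν : ℝ} {X Y : ℕ+ → Ω → ℝ} {H : ℕ+ → ℕ+ → Set Ω}

/-- The joint probabilities of the edges are those of the random bipartite graph. -/
def HasEdgeMoments (μ : Measure Ω) (a b : ℝ) (τ : ℕ+ → ℝ) (X Y : ℕ+ → Ω → ℝ)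
    (H : ℕ+ → ℕ+ → Set Ω) : Prop :=
  ∀ S : Finset (ℕ+ × ℕ+), μ.real (⋂ e ∈ S, H e.1 e.2) =
    ∫ ω, ∏ e ∈ S, edgeProb a b τ e.1 e.2 (X e.1 ω) (Y e.2 ω) ∂μ

theorem HasEdgeMoments.ae_inBand [IsProbabilityMeasure μ]
    (h : HasEdgeMoments μ a b (fun t => (t : ℝ) ^ ν) X Y H) :
    ∀ᵐ ω ∂μ, ∀ i u, ω ∈ H i u → InBand a b ν i u := by
  rw [ae_all_iff]
  intro i
  rw [ae_all_iff]
  intro u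
  by_cases hb : InBand a b ν i u
  · exact ae_of_all _ fun _ _ => hb
  · have h1 := h {(i, u)}
    simp only [Finset.mem_singleton, Set.iInter_iInter_eq_left, Finset.prod_singleton,
      edgeProb_of_not_inBand hb, integral_zero] at h1
    rw [measureReal_eq_zero_iff] at h1
    filter_upwards [measure_eq_zero_iff_ae_notMem.1 h1] with ω hω h2 using absurd h2 hω

theorem measurable_card_paths (hH : ∀ i u, MeasurableSet (H i u)) (t : ℕ+) :
    Measurable (fun ω => (paths a b ν H t ω).card) := by
  classical
  simp only [paths, Finset.card_filter]
  refine Finset.measurable_fun_sum _ fun k _ => ?_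
  exact Measurable.ite ((hH k.1 t).inter (hH k.1 k.2)) measurable_const measurable_const

/-- `degree` counts a subset of all actors, but almost surely no edge lies outside the band, and
there it is a finite sum of indicators of measurable events. -/
theorem aemeasurable_degree [IsProbabilityMeasure μ] (ha : 0 < a) (hab : a < b) (hν : 1 < ν)
    (hH : ∀ i u, MeasurableSet (H i u))
    (h : HasEdgeMoments μ a b (fun t => (t : ℝ) ^ ν) X Y H) (t : ℕ+) :
    AEMeasurable (degree H t) μ := by
  classical
  refine ⟨fun ω => ∑ u ∈ actors a b ν t,
    if ∃ i ∈ items a b ν t, ω ∈ H i t ∧ ω ∈ H i u then 1 else 0, ?_, ?_⟩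
  · refine Finset.measurable_fun_sum _ fun u _ => ?_
    refine Measurable.ite ?_ measurable_const measurable_const
    have : {ω | ∃ i ∈ items a b ν t, ω ∈ H i t ∧ ω ∈ H i u} =
        ⋃ i ∈ items a b ν t, H i t ∩ H i u := by
      ext; simp only [Set.mem_ofPred_eq, Set.mem_iUnion, Set.mem_inter_iff, exists_prop]
    rw [this]
    exact Finset.measurableSet_biUnion _ fun i _ => (hH i t).inter (hH i u)
  · filter_upwards [h.ae_inBand] with ω hω
    rw [degree_eq_card_image ha hab hν hω, ← Finset.card_filter]
    congr 1
    ext u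
    simp only [paths, Finset.mem_image, Finset.mem_filter, Finset.mem_product, Prod.exists,
      exists_eq_right]
    grind

end Moments

/-! ### The limit for bounded weights -/

/-- A random bipartite graph with bounded weights. -/
structure IsBoundedModel {Ω : Type*} {mΩ : MeasurableSpace Ω} (μ : Measure Ω) (a b ν M : ℝ)
    (X Y : ℕ+ → Ω → ℝ) (H : ℕ+ → ℕ+ → Set Ω) : Prop where
  left_pos : 0 < a
  left_lt_right : a < b
  one_lt : 1 < ν
  measurable_item : ∀ i, Measurable (X i)
  measurable_actor : ∀ j, Measurable (Y j)
  item_nonneg : ∀ i ω, 0 ≤ X i ω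
  item_le : ∀ i ω, X i ω ≤ M
  actor_nonneg : ∀ i ω, 0 ≤ Y i ω
  actor_le : ∀ i ω, Y i ω ≤ M
  indep : iIndepFun (Sum.elim X Y) μ
  identDistrib_item : ∀ i, IdentDistrib (X i) (X 1) μ μ
  identDistrib_actor : ∀ j, IdentDistrib (Y j) (Y 1) μ μ
  measurableSet_edge : ∀ i j, MeasurableSet (H i j)
  moments : HasEdgeMoments μ a b (fun t => (t : ℝ) ^ ν) X Y H

namespace IsBoundedModel

variable {Ω : Type*} {mΩ : MeasurableSpace Ω} {μ : Measure Ω} {a b ν M : ℝ}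
  {X Y : ℕ+ → Ω → ℝ} {H : ℕ+ → ℕ+ → Set Ω}

theorem edgeProb_le_eta (hm : IsBoundedModel μ a b ν M X Y H) {i t u : ℕ+}
    (hi : i ∈ items a b ν t) (hu : u = t ∨ u ∈ actors a b ν t) (ω : Ω) :
    edgeProb a b (fun t => (t : ℝ) ^ ν) i u (X i ω) (Y u ω) ≤ M ^ 2 * eta a b ν t := by
  refine (edgeProb_le (hm.item_nonneg i ω) (hm.actor_nonneg u ω)).trans ?_
  have h1 := inv_sqrt_le_eta hm.left_pos hm.left_lt_right hm.one_lt hi hu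
  have h2 := hm.item_le i ω
  have h3 := hm.actor_le u ω
  have h4 := hm.item_nonneg i ω
  have h5 := hm.actor_nonneg u ω
  calc _ ≤ M * M * eta a b ν t := by
        have : 0 ≤ M := h4.trans h2
        gcongr
    _ = _ := by ring

theorem edgeProb_nonneg (hm : IsBoundedModel μ a b ν M X Y H) (i u : ℕ+) (ω : Ω) :
    0 ≤ edgeProb a b (fun t => (t : ℝ) ^ ν) i u (X i ω) (Y u ω) :=
  RandomIntersection.edgeProb_nonneg (hm.item_nonneg i ω) (hm.actor_nonneg u ω)

theorem measurable_edgeProb (hm : IsBoundedModel μ a b ν M X Y H) (i u : ℕ+) :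
    Measurable (fun ω => edgeProb a b (fun t => (t : ℝ) ^ ν) i u (X i ω) (Y u ω)) :=
  (RandomIntersection.measurable_edgeProb (τ := fun t => (t : ℝ) ^ ν) i u).comp
    ((hm.measurable_item i).prodMk (hm.measurable_actor u))

variable [IsProbabilityMeasure μ]

/-- It is unlikely that an actor has two common neighbours with `v_t`. -/
theorem measureReal_two_common_le (hm : IsBoundedModel μ a b ν M X Y H) (t : ℕ+) :
    μ.real (⋃ u ∈ actors a b ν t, ⋃ i ∈ items a b ν t, ⋃ i' ∈ (items a b ν t).erase i,
      H i t ∩ H i u ∩ (H i' t ∩ H i' u)) ≤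
      (actors a b ν t).card * ((items a b ν t).card * ((items a b ν t).card *
        (M ^ 2 * eta a b ν t) ^ 4)) := by
  have hη : 0 ≤ M ^ 2 * eta a b ν t := by
    have := eta_pos (ν := ν) hm.left_pos hm.left_lt_right t; positivity
  refine (measureReal_biUnion_finset_le _ _).trans ?_
  rw [← nsmul_eq_mul]
  refine Finset.sum_le_card_nsmul _ _ _ fun u hu => ?_
  refine (measureReal_biUnion_finset_le _ _).trans ?_
  rw [← nsmul_eq_mul]
  refine Finset.sum_le_card_nsmul _ _ _ fun i hi => ?_
  refine (measureReal_biUnion_finset_le _ _).trans ?_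
  refine (Finset.sum_le_card_nsmul _ _ ((M ^ 2 * eta a b ν t) ^ 4) fun i' hi' => ?_).trans ?_
  · have hut : u ≠ t := Finset.ne_of_mem_erase hu
    have hne : i' ≠ i := Finset.ne_of_mem_erase hi'
    have hi'' := Finset.mem_of_mem_erase hi'
    have h := hm.moments {(i, t), (i, u), (i', t), (i', u)}
    have e : (⋂ e ∈ ({(i, t), (i, u), (i', t), (i', u)} : Finset (ℕ+ × ℕ+)), H e.1 e.2) =
        H i t ∩ H i u ∩ (H i' t ∩ H i' u) := by
      ext ω; simp [and_assoc]
    rw [e] at h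
    rw [h]
    -- The four edges are distinct because `u ≠ t` and `i' ≠ i`, so the moment formula has four
    -- factors, each at most `M ^ 2 * eta a b ν t`.
    have hcard : ({(i, t), (i, u), (i', t), (i', u)} : Finset (ℕ+ × ℕ+)).card = 4 := by
      rw [Finset.card_insert_of_notMem, Finset.card_insert_of_notMem,
        Finset.card_insert_of_notMem, Finset.card_singleton] <;> grind
    have hb : ∀ ω, ∏ e ∈ ({(i, t), (i, u), (i', t), (i', u)} : Finset (ℕ+ × ℕ+)),
        edgeProb a b (fun t => (t : ℝ) ^ ν) e.1 e.2 (X e.1 ω) (Y e.2 ω) ≤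
        (M ^ 2 * eta a b ν t) ^ 4 := fun ω => by
      rw [← hcard, ← Finset.prod_const]
      refine Finset.prod_le_prod (fun e _ => hm.edgeProb_nonneg _ _ _) fun e he => ?_
      simp only [Finset.mem_insert, Finset.mem_singleton] at he
      rcases he with rfl | rfl | rfl | rfl
      exacts [hm.edgeProb_le_eta hi (.inl rfl) ω, hm.edgeProb_le_eta hi (.inr hu) ω,
        hm.edgeProb_le_eta hi'' (.inl rfl) ω, hm.edgeProb_le_eta hi'' (.inr hu) ω]
    refine (integral_mono_of_nonneg (ae_of_all _ fun ω => Finset.prod_nonneg fun e _ =>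
      hm.edgeProb_nonneg _ _ _) (integrable_const _) (ae_of_all _ hb)).trans ?_
    simp
  · rw [nsmul_eq_mul]
    gcongr
    exact Finset.erase_subset _ _

/-- The two powers agree almost surely off the event of two common items, and differ by at most `2`
on it. -/
theorem norm_integral_pow_degree_sub_le (hm : IsBoundedModel μ a b ν M X Y H) (t : ℕ+) {z : ℂ}
    (hz : ‖z‖ ≤ 1) :
    ‖∫ ω, z ^ degree H t ω ∂μ - ∫ ω, z ^ (paths a b ν H t ω).card ∂μ‖ ≤
      2 * ((actors a b ν t).card * ((items a b ν t).card * ((items a b ν t).card *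
        (M ^ 2 * eta a b ν t) ^ 4))) := by
  have hpow : ∀ n : ℕ, ‖z ^ n‖ ≤ 1 := fun n => by
    rw [norm_pow]; exact pow_le_one₀ (norm_nonneg _) hz
  have hi1 : Integrable (fun ω => z ^ degree H t ω) μ :=
    Integrable.of_bound ((measurable_from_nat (f := fun n => z ^ n)).comp_aemeasurable
      (aemeasurable_degree hm.left_pos hm.left_lt_right hm.one_lt hm.measurableSet_edge
      hm.moments t)).aestronglyMeasurable 1 (ae_of_all _ fun ω => hpow _)
  have hi2 : Integrable (fun ω => z ^ (paths a b ν H t ω).card) μ :=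
    Integrable.of_bound ((measurable_from_nat (f := fun n => z ^ n)).comp
      (measurable_card_paths hm.measurableSet_edge t)).aestronglyMeasurable 1
      (ae_of_all _ fun ω => hpow _)
  set B := ⋃ u ∈ actors a b ν t, ⋃ i ∈ items a b ν t, ⋃ i' ∈ (items a b ν t).erase i,
      H i t ∩ H i u ∩ (H i' t ∩ H i' u) with hB
  have hBm : MeasurableSet B := by
    have := hm.measurableSet_edge
    refine Finset.measurableSet_biUnion _ fun u _ => Finset.measurableSet_biUnion _ fun i _ =>
      Finset.measurableSet_biUnion _ fun i' _ => ?_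
    exact ((this _ _).inter (this _ _)).inter ((this _ _).inter (this _ _))
  rw [← integral_sub hi1 hi2]
  have hle : ∀ᵐ ω ∂μ, ‖z ^ degree H t ω - z ^ (paths a b ν H t ω).card‖ ≤
      B.indicator (fun _ => (2 : ℝ)) ω := by
    filter_upwards [hm.moments.ae_inBand] with ω hω
    by_cases h : ω ∈ B
    · rw [Set.indicator_of_mem h]
      exact (norm_sub_le_of_le (hpow _) (hpow _)).trans_eq (by norm_num)
    · rw [Set.indicator_of_notMem h, degree_eq_card_paths hm.left_pos hm.left_lt_right hm.one_lt hω,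
        sub_self, norm_zero]
      intro u hu i hi i' hi' hne hmem
      refine h ?_
      simp only [hB, Set.mem_iUnion]
      exact ⟨u, hu, i, hi, i', Finset.mem_erase.2 ⟨hne.symm, hi'⟩, hmem⟩
  refine (norm_integral_le_of_norm_le ((integrable_const _).indicator hBm) hle).trans ?_
  rw [integral_indicator_const _ hBm, smul_eq_mul, mul_comm]
  exact mul_le_mul_of_nonneg_left (hm.measureReal_two_common_le t) zero_le_two

/-- The generating function of the number of paths is `compoundGen` at the edge indicators; being
multi-affine, it has the same mean at the edge probabilities. -/
theorem integral_pow_card_paths (hm : IsBoundedModel μ a b ν M X Y H) (t : ℕ+) (z : ℂ) :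
    Integrable (fun ω => compoundGen (items a b ν t) (actors a b ν t) z
      (fun i => (edgeProb a b (fun t => (t : ℝ) ^ ν) i t (X i ω) (Y t ω) : ℝ))
      (fun i u => (edgeProb a b (fun t => (t : ℝ) ^ ν) i u (X i ω) (Y u ω) : ℝ))) μ ∧
    ∫ ω, z ^ (paths a b ν H t ω).card ∂μ =
      ∫ ω, compoundGen (items a b ν t) (actors a b ν t) z
      (fun i => (edgeProb a b (fun t => (t : ℝ) ^ ν) i t (X i ω) (Y t ω) : ℝ))
      (fun i u => (edgeProb a b (fun t => (t : ℝ) ^ ν) i u (X i ω) (Y u ω) : ℝ)) ∂μ := by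
  have h := integral_multiAffine μ (E := fun e : ℕ+ × ℕ+ => H e.1 e.2)
    (P := fun e ω => edgeProb a b (fun t => (t : ℝ) ^ ν) e.1 e.2 (X e.1 ω) (Y e.2 ω))
    (fun e => hm.measurableSet_edge _ _) (fun e => hm.measurable_edgeProb _ _)
    (fun e ω => hm.edgeProb_nonneg _ _ _) (fun e ω => edgeProb_le_one) hm.moments
    (compoundGen_mem_multiAffine (items a b ν t) (actors a b ν t) (t := t)
      (Finset.notMem_erase _ _) z)
  simp only [compoundGen_indicator] at h
  exact h.2

theorem norm_integral_pow_card_paths_sub_le (hm : IsBoundedModel μ a b ν M X Y H) (t : ℕ+) {z : ℂ}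
    (hz : ‖z‖ ≤ 1) :
    ‖∫ ω, z ^ (paths a b ν H t ω).card ∂μ - ∫ ω, Complex.exp ((z - 1) *
      (∑ i ∈ items a b ν t, ∑ u ∈ actors a b ν t,
        edgeProb a b (fun t => (t : ℝ) ^ ν) i t (X i ω) (Y t ω) *
        edgeProb a b (fun t => (t : ℝ) ^ ν) i u (X i ω) (Y u ω) : ℝ)) ∂μ‖ ≤
      (items a b ν t).card * (16 * (M ^ 2 * eta a b ν t *
        ((actors a b ν t).card * (M ^ 2 * eta a b ν t)) ^ 2)) := by
  obtain ⟨hi, e⟩ := hm.integral_pow_card_paths t z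
  have hη : 0 ≤ M ^ 2 * eta a b ν t := by
    have := eta_pos (ν := ν) hm.left_pos hm.left_lt_right t; positivity
  have hnn : ∀ ω, 0 ≤ ∑ i ∈ items a b ν t, ∑ u ∈ actors a b ν t,
        edgeProb a b (fun t => (t : ℝ) ^ ν) i t (X i ω) (Y t ω) *
        edgeProb a b (fun t => (t : ℝ) ^ ν) i u (X i ω) (Y u ω) := fun ω =>
    Finset.sum_nonneg fun i _ => Finset.sum_nonneg fun u _ =>
      mul_nonneg (hm.edgeProb_nonneg _ _ _) (hm.edgeProb_nonneg _ _ _)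
  have hi2 : Integrable (fun ω => Complex.exp ((z - 1) *
      (∑ i ∈ items a b ν t, ∑ u ∈ actors a b ν t,
        edgeProb a b (fun t => (t : ℝ) ^ ν) i t (X i ω) (Y t ω) *
        edgeProb a b (fun t => (t : ℝ) ^ ν) i u (X i ω) (Y u ω) : ℝ))) μ := by
    refine Integrable.of_bound (Measurable.aestronglyMeasurable ?_) 1 (ae_of_all _ fun ω =>
      norm_exp_le_one_of_re_nonpos (sub_one_mul_re_nonpos hz (hnn ω)))
    have := hm.measurable_edgeProb
    fun_prop
  rw [e, ← integral_sub hi hi2]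
  refine (norm_integral_le_of_norm_le (integrable_const _) (ae_of_all _ fun ω => ?_)).trans_eq
    (by rw [integral_const, probReal_univ, one_smul])
  refine (norm_compoundGen_sub_exp_le _ _ hz _ _ (fun i _ => hm.edgeProb_nonneg _ _ _)
    (fun i _ => edgeProb_le_one) (fun i _ u _ => hm.edgeProb_nonneg _ _ _)
    (fun i _ u _ => edgeProb_le_one)).trans ?_
  rw [← nsmul_eq_mul]
  refine Finset.sum_le_card_nsmul _ _ _ fun i hi => ?_
  have h1 := hm.edgeProb_le_eta hi (.inl rfl) ω
  have h2 : ∑ u ∈ actors a b ν t, edgeProb a b (fun t => (t : ℝ) ^ ν) i u (X i ω) (Y u ω) ≤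
      (actors a b ν t).card * (M ^ 2 * eta a b ν t) := by
    rw [← nsmul_eq_mul]
    exact Finset.sum_le_card_nsmul _ _ _ fun u hu => hm.edgeProb_le_eta hi (.inr hu) ω
  have h3 : 0 ≤ ∑ u ∈ actors a b ν t, edgeProb a b (fun t => (t : ℝ) ^ ν) i u (X i ω) (Y u ω) :=
    Finset.sum_nonneg fun u _ => hm.edgeProb_nonneg _ _ _
  have h4 := hm.edgeProb_nonneg i t ω
  gcongr

end IsBoundedModel

open Classical in
/-- The coefficient of `X_i ^ 2 * Y_u * Y_t` in the mean number of paths `v_t w_i v_u`. -/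
noncomputable def pathWeight (a b ν : ℝ) (t : ℕ+) (k : ℕ+ × ℕ+) : ℝ :=
  if InBand a b ν k.1 k.2 then (√((k.1 : ℝ) * t))⁻¹ * (√((k.1 : ℝ) * k.2))⁻¹ else 0

theorem pathWeight_nonneg {a b ν : ℝ} (t : ℕ+) (k : ℕ+ × ℕ+) : 0 ≤ pathWeight a b ν t k := by
  rw [pathWeight]; split_ifs <;> positivity

theorem pathWeight_le {a b ν : ℝ} (ha : 0 < a) (hab : a < b) (hν : 1 < ν) {t : ℕ+}
    {k : ℕ+ × ℕ+} (hk : k ∈ items a b ν t ×ˢ actors a b ν t) :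
    pathWeight a b ν t k ≤ eta a b ν t ^ 2 := by
  have hη := (eta_pos (ν := ν) ha hab t).le
  rw [Finset.mem_product] at hk
  rw [pathWeight, sq]
  split_ifs
  · exact mul_le_mul (inv_sqrt_le_eta ha hab hν hk.1 (.inl rfl))
      (inv_sqrt_le_eta ha hab hν hk.1 (.inr hk.2)) (by positivity) hη
  · positivity

theorem tendsto_sum_pathWeight {a b ν : ℝ} (ha : 0 < a) (hab : a < b) (hν : 1 < ν) :
    Tendsto (fun t => ∑ k ∈ items a b ν t ×ˢ actors a b ν t, pathWeight a b ν t k) atTop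
      (𝓝 (gammaConst a b ν)) := by
  convert tendsto_sum_inBand ha hab hν using 2 with t
  rw [Finset.sum_product]
  refine Finset.sum_congr rfl fun i _ => ?_
  rw [Finset.sum_filter]
  rfl

theorem gammaConst_nonneg {a b ν : ℝ} (ha : 0 < a) (hab : a < b) (hν : 1 < ν) :
    0 ≤ gammaConst a b ν :=
  ge_of_tendsto' (tendsto_sum_pathWeight ha hab hν) fun t =>
    Finset.sum_nonneg fun k _ => pathWeight_nonneg t k

namespace IsBoundedModel

variable {Ω : Type*} {mΩ : MeasurableSpace Ω} {μ : Measure Ω} {a b ν M : ℝ}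
  {X Y : ℕ+ → Ω → ℝ} {H : ℕ+ → ℕ+ → Set Ω}

/-- Once `M ^ 2 * eta a b ν t ≤ 1`, which holds for large `t`, the cap at `1` is inactive, so the
conditional mean number of paths is exactly a polynomial in the weights. -/
theorem edgeProb_eq (hm : IsBoundedModel μ a b ν M X Y H) {i t u : ℕ+}
    (hη : M ^ 2 * eta a b ν t ≤ 1) (hi : i ∈ items a b ν t) (hu : u = t ∨ u ∈ actors a b ν t)
    (hb : InBand a b ν i u) (ω : Ω) :
    edgeProb a b (fun t => (t : ℝ) ^ ν) i u (X i ω) (Y u ω) =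
      X i ω * Y u ω * (√((i : ℝ) * u))⁻¹ := by
  rw [edgeProb_of_inBand hb, min_eq_right, div_eq_mul_inv]
  refine le_trans ?_ hη
  rw [div_eq_mul_inv, sq]
  have h2 := hm.item_le i ω
  have h4 := hm.item_nonneg i ω
  have : 0 ≤ M := h4.trans h2
  exact mul_le_mul (mul_le_mul h2 (hm.actor_le u ω) (hm.actor_nonneg u ω) this)
    (inv_sqrt_le_eta hm.left_pos hm.left_lt_right hm.one_lt hi hu) (by positivity) (by positivity)

theorem sum_edgeProb_eq (hm : IsBoundedModel μ a b ν M X Y H) {t : ℕ+}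
    (hη : M ^ 2 * eta a b ν t ≤ 1) (ω : Ω) :
    ∑ i ∈ items a b ν t, ∑ u ∈ actors a b ν t,
        edgeProb a b (fun t => (t : ℝ) ^ ν) i t (X i ω) (Y t ω) *
        edgeProb a b (fun t => (t : ℝ) ^ ν) i u (X i ω) (Y u ω) =
      Y t ω * ∑ k ∈ items a b ν t ×ˢ actors a b ν t,
        pathWeight a b ν t k * (X k.1 ω ^ 2 * Y k.2 ω) := by
  rw [Finset.sum_product, Finset.mul_sum]
  refine Finset.sum_congr rfl fun i hi => ?_
  rw [Finset.mul_sum]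
  refine Finset.sum_congr rfl fun u hu => ?_
  rw [hm.edgeProb_eq hη hi (.inl rfl) (mem_items.1 hi), pathWeight]
  split_ifs with hb
  · rw [hm.edgeProb_eq hη hi (.inr hu) hb]; ring
  · rw [edgeProb_of_not_inBand hb]; ring

variable [IsProbabilityMeasure μ]

theorem integral_abs_weighted_sum_le (hm : IsBoundedModel μ a b ν M X Y H) (t : ℕ+) :
    ∫ ω, |∑ k ∈ items a b ν t ×ˢ actors a b ν t, pathWeight a b ν t k * (X k.1 ω ^ 2 * Y k.2 ω -
      (∫ ω, X 1 ω ^ 2 ∂μ) * ∫ ω, Y 1 ω ∂μ)| ∂μ ≤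
      √(4 * M ^ 6 * ((items a b ν t).card * (actors a b ν t).card *
        ((items a b ν t).card + (actors a b ν t).card) * eta a b ν t ^ 4)) := by
  refine Real.le_sqrt_of_sq_le ((sq_integral_abs_sum_sq_mul_sub_le μ hm.measurable_item
    hm.measurable_actor hm.indep hm.identDistrib_item hm.identDistrib_actor
    (fun i ω => (abs_of_nonneg (hm.item_nonneg i ω)).trans_le (hm.item_le i ω))
    (fun i ω => (abs_of_nonneg (hm.actor_nonneg i ω)).trans_le (hm.actor_le i ω)) _ _
    (pathWeight a b ν t) (δ := eta a b ν t ^ 2) fun k hk => ?_).trans_eq (by ring))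
  rw [abs_of_nonneg (pathWeight_nonneg t k)]
  exact pathWeight_le hm.left_pos hm.left_lt_right hm.one_lt hk

theorem norm_integral_exp_sub_le (hm : IsBoundedModel μ a b ν M X Y H) {t : ℕ+}
    (hη : M ^ 2 * eta a b ν t ≤ 1) {z : ℂ} (hz : ‖z‖ ≤ 1) :
    ‖∫ ω, Complex.exp ((z - 1) * (∑ i ∈ items a b ν t, ∑ u ∈ actors a b ν t,
        edgeProb a b (fun t => (t : ℝ) ^ ν) i t (X i ω) (Y t ω) *
        edgeProb a b (fun t => (t : ℝ) ^ ν) i u (X i ω) (Y u ω) : ℝ)) ∂μ -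
      ∫ ω, Complex.exp ((z - 1) * (limitMean μ a b ν X Y ω : ℝ)) ∂μ‖ ≤
      2 * (M * √(4 * M ^ 6 * ((items a b ν t).card * (actors a b ν t).card *
        ((items a b ν t).card + (actors a b ν t).card) * eta a b ν t ^ 4)) +
      M * (((∫ ω, X 1 ω ^ 2 ∂μ) * ∫ ω, Y 1 ω ∂μ) *
        |∑ k ∈ items a b ν t ×ˢ actors a b ν t, pathWeight a b ν t k - gammaConst a b ν|)) := by
  set m : ℝ := (∫ ω, X 1 ω ^ 2 ∂μ) * ∫ ω, Y 1 ω ∂μ with hmdef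
  set γ := gammaConst a b ν with hγ
  set P := items a b ν t ×ˢ actors a b ν t with hP
  have hM : ∀ ω, 0 ≤ M := fun ω => (hm.item_nonneg 1 ω).trans (hm.item_le 1 ω)
  have hXm := hm.measurable_item
  have hYm := hm.measurable_actor
  have hm0 : 0 ≤ m := mul_nonneg (integral_nonneg fun ω => sq_nonneg _)
    (integral_nonneg fun ω => hm.actor_nonneg 1 ω)
  have hγ0 : 0 ≤ γ := gammaConst_nonneg hm.left_pos hm.left_lt_right hm.one_lt
  -- Replacing `Y_1` by the equidistributed `Y_t` puts the same factor `Y_t` into both exponents,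
  -- which can then be compared pointwise.
  have e1 : ∫ ω, Complex.exp ((z - 1) * (limitMean μ a b ν X Y ω : ℝ)) ∂μ =
      ∫ ω, Complex.exp ((z - 1) * (γ * m * Y t ω : ℝ)) ∂μ := by
    have := ((hm.identDistrib_actor t).comp
      (u := fun y => Complex.exp ((z - 1) * (γ * m * y : ℝ))) (by fun_prop)).integral_eq
    simp only [Function.comp_def] at this
    rw [this]
    refine integral_congr_ae (ae_of_all _ fun ω => ?_)
    simp only [limitMean, hmdef, ← hγ, mul_assoc]
  simp_rw [hm.sum_edgeProb_eq hη]
  rw [e1]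
  have hS0 : ∀ ω, 0 ≤ Y t ω * ∑ k ∈ P, pathWeight a b ν t k * (X k.1 ω ^ 2 * Y k.2 ω) :=
    fun ω => mul_nonneg (hm.actor_nonneg t ω) (Finset.sum_nonneg fun k _ =>
      mul_nonneg (pathWeight_nonneg t k) (mul_nonneg (sq_nonneg _) (hm.actor_nonneg _ ω)))
  have hY0 : ∀ ω, 0 ≤ γ * m * Y t ω := fun ω =>
    mul_nonneg (mul_nonneg hγ0 hm0) (hm.actor_nonneg t ω)
  have hint : ∀ f : Ω → ℝ, Measurable f → (∀ ω, 0 ≤ f ω) →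
      Integrable (fun ω => Complex.exp ((z - 1) * (f ω : ℝ))) μ := fun f hf hf0 =>
    Integrable.of_bound (Measurable.aestronglyMeasurable (by fun_prop)) 1 (ae_of_all _ fun ω =>
      norm_exp_le_one_of_re_nonpos (sub_one_mul_re_nonpos hz (hf0 ω)))
  rw [← integral_sub (hint _ (by fun_prop) hS0) (hint _ (by fun_prop) hY0)]
  have hsum : ∀ ω, ∑ k ∈ P, pathWeight a b ν t k * (X k.1 ω ^ 2 * Y k.2 ω - m) =
      ∑ k ∈ P, pathWeight a b ν t k * (X k.1 ω ^ 2 * Y k.2 ω) -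
        m * ∑ k ∈ P, pathWeight a b ν t k := fun ω => by
    rw [Finset.mul_sum, ← Finset.sum_sub_distrib]
    exact Finset.sum_congr rfl fun k _ => by ring
  have hbd : Integrable (fun ω => |∑ k ∈ P, pathWeight a b ν t k *
      (X k.1 ω ^ 2 * Y k.2 ω - m)|) μ := by
    refine Integrable.abs (integrable_finsetSum _ fun k _ => Integrable.const_mul
      (Integrable.sub ?_ (integrable_const _)) _)
    refine Integrable.of_bound (by fun_prop) (M ^ 2 * M) (ae_of_all _ fun ω => ?_)
    have := hm.item_le k.1 ω
    have := hm.item_nonneg k.1 ω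
    have := hm.actor_le k.2 ω
    have := hm.actor_nonneg k.2 ω
    rw [Real.norm_of_nonneg (by positivity)]
    gcongr
  have hpt : ∀ ω, ‖Complex.exp ((z - 1) *
        (Y t ω * ∑ k ∈ P, pathWeight a b ν t k * (X k.1 ω ^ 2 * Y k.2 ω) : ℝ)) -
      Complex.exp ((z - 1) * (γ * m * Y t ω : ℝ))‖ ≤
      2 * (M * |∑ k ∈ P, pathWeight a b ν t k * (X k.1 ω ^ 2 * Y k.2 ω - m)| +
        M * (m * |∑ k ∈ P, pathWeight a b ν t k - γ|)) := fun ω => by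
    refine (norm_exp_sub_exp_le (sub_one_mul_re_nonpos hz (hS0 ω))
      (sub_one_mul_re_nonpos hz (hY0 ω))).trans ?_
    rw [← mul_sub, norm_mul, ← Complex.ofReal_sub, Complex.norm_real, Real.norm_eq_abs]
    refine mul_le_mul (norm_sub_one_le_two hz) ?_ (abs_nonneg _) zero_le_two
    -- The difference splits into the random fluctuation of the weighted sum and the deterministic
    -- error of the total weight.
    have e : Y t ω * ∑ k ∈ P, pathWeight a b ν t k * (X k.1 ω ^ 2 * Y k.2 ω) - γ * m * Y t ω =
        Y t ω * (∑ k ∈ P, pathWeight a b ν t k * (X k.1 ω ^ 2 * Y k.2 ω - m)) +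
        Y t ω * (m * (∑ k ∈ P, pathWeight a b ν t k - γ)) := by
      rw [hsum]; ring
    rw [e]
    refine (abs_add_le _ _).trans ?_
    rw [abs_mul, abs_mul, abs_mul m, abs_of_nonneg (hm.actor_nonneg t ω), abs_of_nonneg hm0]
    have := hm.actor_le t ω
    gcongr
  refine (norm_integral_le_of_norm_le (((hbd.const_mul M).add (integrable_const _)).const_mul 2)
    (ae_of_all _ hpt)).trans ?_
  rw [integral_const_mul]
  simp only [Pi.add_apply]
  rw [integral_add (hbd.const_mul M) (integrable_const _), integral_const_mul, integral_const,
    probReal_univ, one_smul]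
  have hM' : 0 ≤ M := by
    obtain ⟨ω⟩ := nonempty_of_isProbabilityMeasure μ
    exact hM ω
  gcongr
  exact hm.integral_abs_weighted_sum_le t

theorem tendsto_integral_pow_degree (hm : IsBoundedModel μ a b ν M X Y H) {z : ℂ}
    (hz : ‖z‖ ≤ 1) :
    Tendsto (fun t => ∫ ω, z ^ degree H t ω ∂μ) atTop
      (𝓝 (∫ ω, Complex.exp ((z - 1) * (limitMean μ a b ν X Y ω : ℝ)) ∂μ)) := by
  set m : ℝ := (∫ ω, X 1 ω ^ 2 ∂μ) * ∫ ω, Y 1 ω ∂μ with hmdef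
  have h3 := tendsto_card_mul_eta_pow_three hm.left_pos hm.left_lt_right hm.one_lt
  have h4 := tendsto_card_mul_eta_pow_four hm.left_pos hm.left_lt_right hm.one_lt
  have hS := tendsto_sum_pathWeight hm.left_pos hm.left_lt_right hm.one_lt
  have hη := (tendsto_eta (a := a) (b := b) hm.one_lt).const_mul (M ^ 2)
  rw [mul_zero] at hη
  have hev : ∀ᶠ t in atTop, M ^ 2 * eta a b ν t ≤ 1 := hη.eventually_le_const one_pos
  have hS' := (tendsto_iff_norm_sub_tendsto_zero.1 hS).const_mul m
  have h4' := (h4.const_mul (4 * M ^ 6)).sqrt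
  rw [mul_zero] at hS'
  rw [mul_zero, Real.sqrt_zero] at h4'
  -- The constants are `2 * (M ^ 2) ^ 4` for the two common items and `16 * (M ^ 2) ^ 3` for the
  -- Poisson approximation; the last summand is the law of large numbers.
  have hlim := ((h4.const_mul (2 * M ^ 8)).add (h3.const_mul (16 * M ^ 6))).add
    (((h4'.const_mul M).add (hS'.const_mul M)).const_mul 2)
  simp only [mul_zero, add_zero] at hlim
  rw [tendsto_iff_norm_sub_tendsto_zero]
  refine squeeze_zero' (Eventually.of_forall fun t => norm_nonneg _) ?_ hlim
  filter_upwards [hev] with t ht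
  have hη0 := (eta_pos (ν := ν) hm.left_pos hm.left_lt_right t).le
  refine (norm_sub_le_norm_sub_add_norm_sub _ _ _).trans (add_le_add
    ((norm_sub_le_norm_sub_add_norm_sub _ _ _).trans (add_le_add
      ((hm.norm_integral_pow_degree_sub_le t hz).trans ?_)
      ((hm.norm_integral_pow_card_paths_sub_le t hz).trans_eq ?_)))
    (hm.norm_integral_exp_sub_le ht hz))
  -- The limit of `h4` contains the sum of the two cardinalities; only the items part is needed
  -- here, and the actors part is nonnegative.
  · have : (0 : ℝ) ≤ 2 * M ^ 8 * ((items a b ν t).card * (actors a b ν t).card *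
        (actors a b ν t).card * eta a b ν t ^ 4) := by positivity
    linarith
  · ring

end IsBoundedModel

/-! ### Truncation of the weights -/

section Truncation

/-- The truncation of a weight to `[0, M]`, by `0` outside. -/
noncomputable def trunc (M x : ℝ) : ℝ := (Set.Icc 0 M).indicator id x

variable {M : ℝ}

theorem measurable_trunc : Measurable (trunc M) := measurable_id.indicator measurableSet_Icc

theorem trunc_of_mem {x : ℝ} (h : x ∈ Set.Icc 0 M) : trunc M x = x := Set.indicator_of_mem h _

theorem trunc_of_notMem {x : ℝ} (h : x ∉ Set.Icc 0 M) : trunc M x = 0 :=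
  Set.indicator_of_notMem h _

theorem trunc_nonneg (x : ℝ) : 0 ≤ trunc M x := Set.indicator_nonneg (fun _ h => h.1) x

theorem trunc_le (hM : 0 ≤ M) (x : ℝ) : trunc M x ≤ M :=
  Set.indicator_apply_le' (fun h => h.2) fun _ => hM

theorem abs_trunc_le (x : ℝ) : |trunc M x| ≤ |x| := by
  by_cases h : x ∈ Set.Icc 0 M
  · rw [trunc_of_mem h]
  · rw [trunc_of_notMem h, abs_zero]; exact abs_nonneg x

theorem tendsto_trunc {x : ℝ} (hx : 0 ≤ x) :
    Tendsto (fun n : ℕ => trunc n x) atTop (𝓝 x) := by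
  refine tendsto_const_nhds.congr' ?_
  filter_upwards [eventually_ge_atTop ⌈x⌉₊] with n hn
  exact (trunc_of_mem ⟨hx, Nat.ceil_le.1 hn⟩).symm

/-- A weight cut to `0` makes the edge probability vanish. Truncating the weights thus amounts to
deleting edges, and the truncated graph is a subgraph on the same probability space. -/
theorem edgeProb_trunc {a b : ℝ} {τ : ℕ+ → ℝ} (i u : ℕ+) (x y : ℝ) :
    edgeProb a b τ i u (trunc M x) (trunc M y) =
      if x ∈ Set.Icc 0 M ∧ y ∈ Set.Icc 0 M then edgeProb a b τ i u x y else 0 := by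
  split_ifs with h
  · rw [trunc_of_mem h.1, trunc_of_mem h.2]
  · rw [edgeProb]
    have : trunc M x * trunc M y = 0 := by
      rcases not_and_or.1 h with h | h
      · rw [trunc_of_notMem h, zero_mul]
      · rw [trunc_of_notMem h, mul_zero]
    simp [this]

variable {Ω : Type*} {mΩ : MeasurableSpace Ω} {μ : Measure Ω} [IsProbabilityMeasure μ]
  {a b ν : ℝ} {X Y : ℕ+ → Ω → ℝ} {H : ℕ+ → ℕ+ → Set Ω}

theorem weightSigma_le (hXm : ∀ i, Measurable (X i)) (hYm : ∀ j, Measurable (Y j)) :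
    weightSigma X Y ≤ mΩ :=
  Measurable.comap_le (by fun_prop)

theorem measurable_weightSigma_item (i : ℕ+) : Measurable[weightSigma X Y] (X i) :=
  ((measurable_pi_apply i).comp measurable_fst).comp (comap_measurable fun ω => ((fun i => X i ω), fun j => Y j ω))

theorem measurable_weightSigma_actor (j : ℕ+) : Measurable[weightSigma X Y] (Y j) :=
  ((measurable_pi_apply j).comp measurable_snd).comp (comap_measurable fun ω => ((fun i => X i ω), fun j => Y j ω))

/-- The defining property of conditional expectation, tested on an event `B` of the weights. Such
`B` express both the truncation and its failure. -/
theorem measureReal_iInter_edges_inter {τ : ℕ+ → ℝ} (hXm : ∀ i, Measurable (X i))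
    (hYm : ∀ j, Measurable (Y j)) (hH : IsRandomBipartiteGraph μ a b τ X Y H)
    (S : Finset (ℕ+ × ℕ+)) {B : Set Ω} (hB : MeasurableSet[weightSigma X Y] B) :
    μ.real ((⋂ e ∈ S, H e.1 e.2) ∩ B) =
      ∫ ω in B, ∏ e ∈ S, edgeProb a b τ e.1 e.2 (X e.1 ω) (Y e.2 ω) ∂μ := by
  have hle := weightSigma_le hXm hYm
  have hms : MeasurableSet (⋂ e ∈ S, H e.1 e.2) :=
    S.measurableSet_biInter fun e _ => hH.measurableSet_edge _ _
  rw [← setIntegral_congr_ae (hle _ hB) ((hH.condProb_edges S).mono fun ω h _ => h),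
    setIntegral_condExp hle ((integrable_const _).indicator hms) hB,
    integral_indicator_const _ hms, measureReal_restrict_apply hms, smul_eq_mul, mul_one]

theorem hasEdgeMoments_of_isRandomBipartiteGraph {τ : ℕ+ → ℝ} (hXm : ∀ i, Measurable (X i))
    (hYm : ∀ j, Measurable (Y j)) (hH : IsRandomBipartiteGraph μ a b τ X Y H) :
    HasEdgeMoments μ a b τ X Y H := fun S => by
  simpa using measureReal_iInter_edges_inter hXm hYm hH S MeasurableSet.univ

/-- The edges between vertices with weights in `[0, M]`. -/
def truncEdge (M : ℝ) (X Y : ℕ+ → Ω → ℝ) (H : ℕ+ → ℕ+ → Set Ω) (i u : ℕ+) : Set Ω :=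
  H i u ∩ {ω | X i ω ∈ Set.Icc 0 M ∧ Y u ω ∈ Set.Icc 0 M}

theorem measurableSet_good (hX : ∀ i, Measurable (X i)) (hY : ∀ j, Measurable (Y j)) (i u : ℕ+) :
    MeasurableSet {ω | X i ω ∈ Set.Icc 0 M ∧ Y u ω ∈ Set.Icc 0 M} :=
  (hX i measurableSet_Icc).inter (hY u measurableSet_Icc)

/-- The edge moments survive since the event that all weights concerned lie in `[0, M]` is
measurable with respect to the weights. Truncation also turns almost sure nonnegativity into
nonnegativity everywhere. -/
theorem isBoundedModel_trunc (ha : 0 < a) (hab : a < b) (hν : 1 < ν) (hM : 0 ≤ M)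
    (hXm : ∀ i, Measurable (X i)) (hYm : ∀ j, Measurable (Y j))
    (hindep : iIndepFun (Sum.elim X Y) μ)
    (hXid : ∀ i, IdentDistrib (X i) (X 1) μ μ) (hYid : ∀ j, IdentDistrib (Y j) (Y 1) μ μ)
    (hH : IsRandomBipartiteGraph μ a b (fun t => (t : ℝ) ^ ν) X Y H) :
    IsBoundedModel μ a b ν M (fun i ω => trunc M (X i ω)) (fun j ω => trunc M (Y j ω))
      (truncEdge M X Y H) where
  left_pos := ha
  left_lt_right := hab
  one_lt := hν
  measurable_item i := measurable_trunc.comp (hXm i)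
  measurable_actor j := measurable_trunc.comp (hYm j)
  item_nonneg i ω := trunc_nonneg _
  item_le i ω := trunc_le hM _
  actor_nonneg i ω := trunc_nonneg _
  actor_le i ω := trunc_le hM _
  indep := by
    convert hindep.comp (fun _ => trunc M) fun _ => measurable_trunc using 1
    funext s
    cases s <;> rfl
  identDistrib_item i := (hXid i).comp measurable_trunc
  identDistrib_actor j := (hYid j).comp measurable_trunc
  measurableSet_edge i j := (hH.measurableSet_edge i j).inter (measurableSet_good hXm hYm i j)
  moments S := by
    have e : (⋂ e ∈ S, truncEdge M X Y H e.1 e.2) = (⋂ e ∈ S, H e.1 e.2) ∩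
        ⋂ e ∈ S, {ω | X e.1 ω ∈ Set.Icc 0 M ∧ Y e.2 ω ∈ Set.Icc 0 M} := by
      simp only [truncEdge, Set.iInter_inter_distrib]
    have hB : MeasurableSet[weightSigma X Y]
        (⋂ e ∈ S, {ω | X e.1 ω ∈ Set.Icc 0 M ∧ Y e.2 ω ∈ Set.Icc 0 M}) :=
      MeasurableSet.biInter S.countable_toSet fun e _ =>
        @measurableSet_good M Ω (weightSigma X Y) X Y measurable_weightSigma_item
          measurable_weightSigma_actor e.1 e.2
    rw [e, measureReal_iInter_edges_inter hXm hYm hH S hB,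
      ← integral_indicator (weightSigma_le hXm hYm _ hB)]
    refine integral_congr_ae (ae_of_all _ fun ω => ?_)
    simp only [edgeProb_trunc]
    by_cases h : ∀ e ∈ S, X e.1 ω ∈ Set.Icc 0 M ∧ Y e.2 ω ∈ Set.Icc 0 M
    · rw [Set.indicator_of_mem (Set.mem_iInter₂.2 h)]
      exact Finset.prod_congr rfl fun e he => (if_pos (h e he)).symm
    · rw [Set.indicator_of_notMem fun h' => h (Set.mem_iInter₂.1 h')]
      push Not at h
      obtain ⟨e, he, hne⟩ := h
      exact (Finset.prod_eq_zero he (if_neg fun h' => hne h'.1 h'.2)).symm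

/-- A neighbour can be lost only through the weight of `v_t` itself or through a path with an item
or endpoint of weight outside `[0, M]`. -/
theorem neighborSet_truncEdge (ha : 0 < a) (hab : a < b) (hν : 1 < ν) {ω : Ω} {t : ℕ+}
    (hω : ∀ i u, ω ∈ H i u → InBand a b ν i u) (hY : Y t ω ∈ Set.Icc 0 M)
    (h : ∀ i ∈ items a b ν t, ∀ u ∈ actors a b ν t, ω ∉ H i t ∩ H i u ∩
      {ω | X i ω ∈ Set.Icc 0 M ∧ Y u ω ∈ Set.Icc 0 M}ᶜ) :
    (intersectionGraph H ω).neighborSet t =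
      (intersectionGraph (truncEdge M X Y H) ω).neighborSet t := by
  ext u
  simp only [SimpleGraph.mem_neighborSet, intersectionGraph]
  refine and_congr_right fun htu => exists_congr fun i => ?_
  simp only [truncEdge, Set.mem_inter_iff, Set.mem_ofPred_eq]
  constructor
  · rintro ⟨hit, hiu⟩
    have h1 := h i (mem_items.2 (hω i t hit)) u
      (mem_actors ha hab hν htu.symm (hω i t hit) (hω i u hiu))
    simp only [Set.mem_inter_iff, hit, hiu, true_and, Set.mem_compl_iff, not_not,
      Set.mem_ofPred_eq] at h1
    exact ⟨⟨hit, h1.1, hY⟩, hiu, h1⟩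
  · rintro ⟨⟨hit, -⟩, hiu, -⟩
    exact ⟨hit, hiu⟩

end Truncation

/-! ### The error of truncation -/

section TruncationError

variable {Ω : Type*} {mΩ : MeasurableSpace Ω} {μ : Measure Ω}
  {a b ν M : ℝ} {X Y : ℕ+ → Ω → ℝ} {H : ℕ+ → ℕ+ → Set Ω}

theorem integral_comp_mul_comp_mul (hXm : ∀ i, Measurable (X i)) (hYm : ∀ j, Measurable (Y j))
    (hindep : iIndepFun (Sum.elim X Y) μ)
    (hXid : ∀ i, IdentDistrib (X i) (X 1) μ μ) (hYid : ∀ j, IdentDistrib (Y j) (Y 1) μ μ)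
    (hY1 : Integrable (Y 1) μ) {f g : ℝ → ℝ} (hf : Measurable f) (hg : Measurable g)
    (hfX : Integrable (fun ω => f (X 1 ω)) μ) (hgY : Integrable (fun ω => g (Y 1 ω)) μ)
    (i : ℕ+) {u t : ℕ+} (hut : u ≠ t) :
    Integrable (fun ω => f (X i ω) * g (Y u ω) * Y t ω) μ ∧
    ∫ ω, f (X i ω) * g (Y u ω) * Y t ω ∂μ =
      (∫ ω, f (X 1 ω) ∂μ) * (∫ ω, g (Y 1 ω) ∂μ) * ∫ ω, Y 1 ω ∂μ := by
  have h1 : IndepFun (fun ω => f (X i ω)) (fun ω => g (Y u ω)) μ :=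
    (hindep.indepFun (i := .inl i) (j := .inr u) (by simp)).comp hf hg
  have h2 : IndepFun (fun ω => f (X i ω) * g (Y u ω)) (Y t) μ :=
    (hindep.indepFun_prodMk (by rintro (i | i); exacts [hXm i, hYm i])
      (.inl i) (.inr u) (.inr t) (by simp) (by simpa using hut)).comp
      (φ := fun x : ℝ × ℝ => f x.1 * g x.2) (ψ := id) (by fun_prop) measurable_id
  have hXi := (hXid i).comp hf
  have hYu := (hYid u).comp hg
  have i1 : Integrable (fun ω => f (X i ω)) μ := hXi.integrable_iff.2 hfX
  have i2 : Integrable (fun ω => g (Y u ω)) μ := hYu.integrable_iff.2 hgY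
  have i3 : Integrable (Y t) μ := (hYid t).integrable_iff.2 hY1
  have i12 : Integrable (fun ω => f (X i ω) * g (Y u ω)) μ := h1.integrable_mul i1 i2
  refine ⟨h2.integrable_mul i12 i3, ?_⟩
  rw [h2.integral_fun_mul_eq_mul_integral i12.aestronglyMeasurable i3.aestronglyMeasurable,
    h1.integral_fun_mul_eq_mul_integral i1.aestronglyMeasurable i2.aestronglyMeasurable,
    (hYid t).integral_eq]
  congr 2
  exacts [hXi.integral_eq, hYu.integral_eq]

/-- The contribution of the weights outside `[0, M]` to the mean number of paths of length two,
up to the weights of the paths. -/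
noncomputable def tailMean (μ : Measure Ω) (X Y : ℕ+ → Ω → ℝ) (M : ℝ) : ℝ :=
  ((∫ ω, (Set.Icc 0 M)ᶜ.indicator (fun x => x ^ 2) (X 1 ω) ∂μ) * (∫ ω, Y 1 ω ∂μ) +
    (∫ ω, X 1 ω ^ 2 ∂μ) * ∫ ω, (Set.Icc 0 M)ᶜ.indicator id (Y 1 ω) ∂μ) * ∫ ω, Y 1 ω ∂μ

theorem tendsto_integral_indicator_compl_Icc {Z : Ω → ℝ} (hZm : Measurable Z)
    (hZ0 : ∀ᵐ ω ∂μ, 0 ≤ Z ω) {f : ℝ → ℝ} (hf : Measurable f)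
    (hfZ : Integrable (fun ω => f (Z ω)) μ) :
    Tendsto (fun n : ℕ => ∫ ω, (Set.Icc 0 (n : ℝ))ᶜ.indicator f (Z ω) ∂μ) atTop (𝓝 0) := by
  rw [show 𝓝 (0 : ℝ) = 𝓝 (∫ _, (0 : ℝ) ∂μ) by rw [integral_zero]]
  refine tendsto_integral_of_dominated_convergence (fun ω => |f (Z ω)|) (fun n =>
    ((hf.indicator measurableSet_Icc.compl).comp hZm).aestronglyMeasurable) hfZ.abs
    (fun n => ae_of_all _ fun ω => norm_indicator_le_norm_self _ _) ?_
  filter_upwards [hZ0] with ω hω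
  refine tendsto_const_nhds.congr' ?_
  filter_upwards [eventually_ge_atTop ⌈Z ω⌉₊] with n hn
  have hmem : Z ω ∈ Set.Icc 0 (n : ℝ) := ⟨hω, Nat.ceil_le.1 hn⟩
  exact (Set.indicator_of_notMem (not_not.2 hmem) f).symm

theorem tendsto_tailMean (hXm : ∀ i, Measurable (X i)) (hYm : ∀ j, Measurable (Y j))
    (hX0 : ∀ i, ∀ᵐ ω ∂μ, 0 ≤ X i ω) (hY0 : ∀ j, ∀ᵐ ω ∂μ, 0 ≤ Y j ω)
    (hX2 : Integrable (fun ω => X 1 ω ^ 2) μ) (hY1 : Integrable (Y 1) μ) :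
    Tendsto (fun n : ℕ => tailMean μ X Y n) atTop (𝓝 0) := by
  have h1 := tendsto_integral_indicator_compl_Icc (hXm 1) (hX0 1) (f := fun x => x ^ 2)
    (by fun_prop) hX2
  have h2 := tendsto_integral_indicator_compl_Icc (hYm 1) (hY0 1) (f := id) measurable_id hY1
  simpa only [tailMean, zero_mul, mul_zero, add_zero] using ((h1.mul_const (∫ ω, Y 1 ω ∂μ)).add
    (h2.const_mul (∫ ω, X 1 ω ^ 2 ∂μ))).mul_const (∫ ω, Y 1 ω ∂μ)

variable [IsProbabilityMeasure μ]

/-- Off the good event the weight of the item or that of the endpoint is out of range. The product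
of the two edge probabilities is at most the path weight times `X_i ^ 2 * Y_u * Y_t`; the two cases
give the two summands of `tailMean`. -/
theorem measureReal_path_inter_bad_le
    (hXm : ∀ i, Measurable (X i)) (hYm : ∀ j, Measurable (Y j))
    (hX0 : ∀ i, ∀ᵐ ω ∂μ, 0 ≤ X i ω) (hY0 : ∀ j, ∀ᵐ ω ∂μ, 0 ≤ Y j ω)
    (hindep : iIndepFun (Sum.elim X Y) μ)
    (hXid : ∀ i, IdentDistrib (X i) (X 1) μ μ) (hYid : ∀ j, IdentDistrib (Y j) (Y 1) μ μ)
    (hX2 : Integrable (fun ω => X 1 ω ^ 2) μ) (hY1 : Integrable (Y 1) μ)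
    (hH : IsRandomBipartiteGraph μ a b (fun t => (t : ℝ) ^ ν) X Y H) (i : ℕ+) {u t : ℕ+}
    (hut : u ≠ t) :
    μ.real (H i t ∩ H i u ∩ {ω | X i ω ∈ Set.Icc 0 M ∧ Y u ω ∈ Set.Icc 0 M}ᶜ) ≤
      pathWeight a b ν t (i, u) * tailMean μ X Y M := by
  set G := {ω | X i ω ∈ Set.Icc 0 M ∧ Y u ω ∈ Set.Icc 0 M} with hG
  have hGm : MeasurableSet Gᶜ := (measurableSet_good hXm hYm i u).compl
  have h := measureReal_iInter_edges_inter hXm hYm hH {(i, t), (i, u)} (B := Gᶜ)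
    (MeasurableSet.compl (@measurableSet_good M Ω (weightSigma X Y) X Y
      measurable_weightSigma_item measurable_weightSigma_actor i u))
  have e : (⋂ e ∈ ({(i, t), (i, u)} : Finset (ℕ+ × ℕ+)), H e.1 e.2) = H i t ∩ H i u := by
    ext ω; simp
  rw [e] at h
  rw [h, ← integral_indicator hGm]
  have hne : (i, t) ∉ ({(i, u)} : Finset (ℕ+ × ℕ+)) := by simpa using hut.symm
  simp only [Finset.prod_insert hne, Finset.prod_singleton]
  set f : ℝ → ℝ := (Set.Icc 0 M)ᶜ.indicator fun x => x ^ 2 with hf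
  set g : ℝ → ℝ := (Set.Icc 0 M)ᶜ.indicator id with hg
  have hfm : Measurable f := Measurable.indicator (by fun_prop) measurableSet_Icc.compl
  have hgm : Measurable g := measurable_id.indicator measurableSet_Icc.compl
  have hfX : Integrable (fun ω => f (X 1 ω)) μ :=
    hX2.mono (hfm.comp (hXm 1)).aestronglyMeasurable
      (ae_of_all _ fun ω => norm_indicator_le_norm_self (fun x => x ^ 2) (X 1 ω))
  have hgY : Integrable (fun ω => g (Y 1 ω)) μ :=
    hY1.mono (hgm.comp (hYm 1)).aestronglyMeasurable
      (ae_of_all _ fun ω => norm_indicator_le_norm_self id (Y 1 ω))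
  obtain ⟨i1, e1⟩ := integral_comp_mul_comp_mul hXm hYm hindep hXid hYid hY1 hfm
    (g := fun y => y) measurable_id hfX hY1 i hut
  obtain ⟨i2, e2⟩ := integral_comp_mul_comp_mul hXm hYm hindep hXid hYid hY1
    (f := fun x => x ^ 2) (by fun_prop) hgm hX2 hgY i hut
  have hR : pathWeight a b ν t (i, u) * tailMean μ X Y M = ∫ ω, pathWeight a b ν t (i, u) *
      (f (X i ω) * Y u ω * Y t ω + X i ω ^ 2 * g (Y u ω) * Y t ω) ∂μ := by
    rw [integral_const_mul, integral_add i1 i2, e1, e2, tailMean]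
    ring
  rw [hR]
  refine integral_mono_of_nonneg ?_ ((i1.add i2).const_mul _) ?_
  · filter_upwards [hX0 i, hY0 u, hY0 t] with ω h1 h2 h3
    exact Set.indicator_apply_nonneg fun _ =>
      mul_nonneg (edgeProb_nonneg h1 h3) (edgeProb_nonneg h1 h2)
  · filter_upwards [hX0 i, hY0 u, hY0 t] with ω h1 h2 h3
    have hf0 : 0 ≤ f (X i ω) := Set.indicator_nonneg (fun _ _ => sq_nonneg _) _
    have hg0 : 0 ≤ g (Y u ω) := Set.indicator_apply_nonneg fun _ => h2
    have hw := pathWeight_nonneg (a := a) (b := b) (ν := ν) t (i, u)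
    refine Set.indicator_apply_le' (fun hω => ?_) fun _ => by positivity
    by_cases hb : InBand a b ν i u
    · calc _ ≤ X i ω * Y t ω * (√((i : ℝ) * t))⁻¹ * (X i ω * Y u ω * (√((i : ℝ) * u))⁻¹) :=
            mul_le_mul (edgeProb_le h1 h3) (edgeProb_le h1 h2) (edgeProb_nonneg h1 h2)
              (by positivity)
        _ = pathWeight a b ν t (i, u) * (X i ω ^ 2 * Y u ω * Y t ω) := by
            rw [pathWeight, if_pos hb]; ring
        _ ≤ _ := by
            refine mul_le_mul_of_nonneg_left ?_ hw
            rcases not_and_or.1 hω with h' | h'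
            · have : f (X i ω) = X i ω ^ 2 := Set.indicator_of_mem h' _
              rw [this]
              exact le_add_of_nonneg_right (by positivity)
            · have : g (Y u ω) = Y u ω := Set.indicator_of_mem h' _
              rw [this]
              exact le_add_of_nonneg_left (by positivity)
    · rw [edgeProb_of_not_inBand hb, mul_zero]
      positivity

/-- A union bound over `v_t` and the paths. The dependence on `t` is only through the total path
weight, which converges, so the error is small uniformly in large `t`. -/
theorem norm_integral_pow_degree_sub_truncEdge_le (ha : 0 < a) (hab : a < b) (hν : 1 < ν)
    (hXm : ∀ i, Measurable (X i)) (hYm : ∀ j, Measurable (Y j))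
    (hX0 : ∀ i, ∀ᵐ ω ∂μ, 0 ≤ X i ω) (hY0 : ∀ j, ∀ᵐ ω ∂μ, 0 ≤ Y j ω)
    (hindep : iIndepFun (Sum.elim X Y) μ)
    (hXid : ∀ i, IdentDistrib (X i) (X 1) μ μ) (hYid : ∀ j, IdentDistrib (Y j) (Y 1) μ μ)
    (hX2 : Integrable (fun ω => X 1 ω ^ 2) μ) (hY1 : Integrable (Y 1) μ)
    (hH : IsRandomBipartiteGraph μ a b (fun t => (t : ℝ) ^ ν) X Y H) (hM : 0 ≤ M)
    {z : ℂ} (hz : ‖z‖ ≤ 1) (t : ℕ+) :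
    ‖∫ ω, z ^ degree H t ω ∂μ - ∫ ω, z ^ degree (truncEdge M X Y H) t ω ∂μ‖ ≤
      2 * (∫ ω, (Set.Icc 0 M)ᶜ.indicator 1 (Y 1 ω) ∂μ +
        (∑ k ∈ items a b ν t ×ˢ actors a b ν t, pathWeight a b ν t k) * tailMean μ X Y M) := by
  have hmom := hasEdgeMoments_of_isRandomBipartiteGraph hXm hYm hH
  have hb := isBoundedModel_trunc ha hab hν hM hXm hYm hindep hXid hYid hH
  have hpow : ∀ n : ℕ, ‖z ^ n‖ ≤ 1 := fun n => by
    rw [norm_pow]; exact pow_le_one₀ (norm_nonneg _) hz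
  have hint : ∀ d : Ω → ℕ, AEMeasurable d μ → Integrable (fun ω => z ^ d ω) μ := fun d hd =>
    Integrable.of_bound ((measurable_from_nat (f := fun n => z ^ n)).comp_aemeasurable
      hd).aestronglyMeasurable 1 (ae_of_all _ fun ω => hpow _)
  have hi1 := hint _ (aemeasurable_degree ha hab hν hH.measurableSet_edge hmom t)
  have hi2 := hint _ (aemeasurable_degree ha hab hν hb.measurableSet_edge hb.moments t)
  rw [← integral_sub hi1 hi2]
  set B := {ω | Y t ω ∈ (Set.Icc 0 M)ᶜ} ∪ ⋃ k ∈ items a b ν t ×ˢ actors a b ν t,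
    H k.1 t ∩ H k.1 k.2 ∩ {ω | X k.1 ω ∈ Set.Icc 0 M ∧ Y k.2 ω ∈ Set.Icc 0 M}ᶜ with hB
  have hYB : MeasurableSet {ω | Y t ω ∈ (Set.Icc 0 M)ᶜ} := hYm t measurableSet_Icc.compl
  have hBm : MeasurableSet B := by
    refine hYB.union (Finset.measurableSet_biUnion _ fun k _ => ?_)
    exact ((hH.measurableSet_edge _ _).inter (hH.measurableSet_edge _ _)).inter
      (measurableSet_good hXm hYm _ _).compl
  have hle : ∀ᵐ ω ∂μ, ‖z ^ degree H t ω - z ^ degree (truncEdge M X Y H) t ω‖ ≤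
      B.indicator (fun _ => (2 : ℝ)) ω := by
    filter_upwards [hmom.ae_inBand] with ω hω
    by_cases h : ω ∈ B
    · rw [Set.indicator_of_mem h]
      exact (norm_sub_le_of_le (hpow _) (hpow _)).trans_eq (by norm_num)
    · rw [hB, Set.mem_union, not_or] at h
      rw [degree, degree, neighborSet_truncEdge ha hab hν hω (not_not.1 h.1), sub_self, norm_zero]
      · exact Set.indicator_nonneg (fun _ _ => zero_le_two) _
      · intro i hi u hu hmem
        exact h.2 (Set.mem_iUnion₂.2 ⟨(i, u), Finset.mk_mem_product hi hu, hmem⟩)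
  refine (norm_integral_le_of_norm_le ((integrable_const _).indicator hBm) hle).trans ?_
  rw [integral_indicator_const _ hBm, smul_eq_mul, mul_comm]
  refine mul_le_mul_of_nonneg_left ((measureReal_union_le _ _).trans (add_le_add ?_ ?_))
    zero_le_two
  · have e : ∫ ω, (Set.Icc 0 M)ᶜ.indicator (1 : ℝ → ℝ) (Y 1 ω) ∂μ =
        ∫ ω, (Set.Icc 0 M)ᶜ.indicator (1 : ℝ → ℝ) (Y t ω) ∂μ :=
      ((hYid t).comp (measurable_one.indicator measurableSet_Icc.compl)).integral_eq.symm
    have e' : (fun ω => (Set.Icc 0 M)ᶜ.indicator (1 : ℝ → ℝ) (Y t ω)) =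
        {ω | Y t ω ∈ (Set.Icc 0 M)ᶜ}.indicator 1 := rfl
    rw [e, e', integral_indicator_one hYB]
  · rw [Finset.sum_mul]
    refine (measureReal_biUnion_finset_le _ _).trans (Finset.sum_le_sum fun k hk => ?_)
    exact measureReal_path_inter_bad_le hXm hYm hX0 hY0 hindep hXid hYid hX2 hY1 hH k.1
      (Finset.ne_of_mem_erase (Finset.mem_product.1 hk).2)

end TruncationError

/-! ### The mixed Poisson law -/

section MixedPoisson

/-- This identifies characteristic functions with generating functions on the unit circle. -/
theorem charFun_map_natCast (Q : Measure ℕ) (θ : ℝ) :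
    charFun (Q.map (Nat.cast : ℕ → ℝ)) θ = ∫ n : ℕ, Complex.exp (θ * Complex.I) ^ n ∂Q := by
  rw [charFun_apply, integral_map Measurable.of_discrete.aemeasurable (by fun_prop)]
  refine integral_congr_ae (ae_of_all _ fun n => ?_)
  simp only [Real.inner_apply, ← Complex.exp_nat_mul]
  congr 1
  push_cast
  ring

variable {Ω : Type*} {mΩ : MeasurableSpace Ω} (μ : Measure Ω)

theorem measurable_poissonMeasure : Measurable poissonMeasure := by
  refine Measure.measurable_of_measurable_coe _ fun s hs => ?_
  simp only [poissonMeasure, Measure.sum_apply _ hs, Measure.smul_apply, smul_eq_mul]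
  refine Measurable.tsum fun n => Measurable.mul_const ?_ _
  fun_prop

/-- The Poisson kernel with the random mean `lam`. -/
noncomputable def poissonKernel (lam : Ω → ℝ) (h : Measurable lam) : Kernel Ω ℕ :=
  ⟨fun ω => poissonMeasure (lam ω).toNNReal, measurable_poissonMeasure.comp h.real_toNNReal⟩

instance (lam : Ω → ℝ) (h : Measurable lam) : IsMarkovKernel (poissonKernel lam h) :=
  ⟨fun ω => inferInstanceAs (IsProbabilityMeasure (poissonMeasure (lam ω).toNNReal))⟩

/-- The mixed Poisson law with the random mean `lam`. -/
noncomputable def mixedPoisson (lam : Ω → ℝ) (h : Measurable lam) : Measure ℕ :=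
  (poissonKernel lam h ∘ₖ Kernel.const Unit μ) ()

instance [IsProbabilityMeasure μ] (lam : Ω → ℝ) (h : Measurable lam) :
    IsProbabilityMeasure (mixedPoisson μ lam h) :=
  inferInstanceAs (IsProbabilityMeasure ((poissonKernel lam h ∘ₖ Kernel.const Unit μ) ()))

theorem mixedPoisson_real_singleton {lam : Ω → ℝ} (h : Measurable lam)
    (h0 : ∀ᵐ ω ∂μ, 0 ≤ lam ω) (r : ℕ) :
    (mixedPoisson μ lam h).real {r} =
      ∫ ω, Real.exp (-lam ω) * lam ω ^ r / (r.factorial : ℝ) ∂μ := by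
  rw [measureReal_def, mixedPoisson, Kernel.comp_apply' _ _ _ (measurableSet_singleton r),
    Kernel.const_apply, ← integral_toReal
      ((poissonKernel lam h).measurable_coe (measurableSet_singleton r)).aemeasurable
      (ae_of_all _ fun ω => measure_lt_top _ _)]
  refine integral_congr_ae (h0.mono fun ω hω => ?_)
  change (poissonMeasure (lam ω).toNNReal).real {r} = _
  rw [poissonMeasure_real_singleton, Real.coe_toNNReal _ hω]

theorem integral_pow_mixedPoisson [IsProbabilityMeasure μ] {lam : Ω → ℝ} (h : Measurable lam)
    (h0 : ∀ᵐ ω ∂μ, 0 ≤ lam ω) (θ : ℝ) :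
    ∫ n : ℕ, Complex.exp (θ * Complex.I) ^ n ∂(mixedPoisson μ lam h) =
      ∫ ω, Complex.exp ((Complex.exp (θ * Complex.I) - 1) * (lam ω : ℝ)) ∂μ := by
  rw [mixedPoisson, Kernel.integral_comp, Kernel.const_apply]
  · refine integral_congr_ae (h0.mono fun ω hω => ?_)
    change ∫ n : ℕ, Complex.exp (θ * Complex.I) ^ n ∂(poissonMeasure (lam ω).toNNReal) = _
    rw [← charFun_map_natCast, charFun_map_cast_poissonMeasure, mul_comm]
    congr 3
    exact Real.coe_toNNReal _ hω
  · refine Integrable.of_bound Measurable.of_discrete.aestronglyMeasurable 1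
      (ae_of_all _ fun n => ?_)
    rw [norm_pow, Complex.norm_exp_ofReal_mul_I, one_pow]

end MixedPoisson

/-! ### Convergence in distribution from generating functions -/

section Levy

variable {Ω : Type*} {mΩ : MeasurableSpace Ω} {μ : Measure Ω} [IsProbabilityMeasure μ]

/-- Weak convergence of laws on `ℕ` can be tested on the real line. -/
theorem tendsto_probabilityMeasure_nat_of_map_cast {ι : Type*} {l : Filter ι}
    {P : ι → ProbabilityMeasure ℕ} {Q : ProbabilityMeasure ℕ}
    (h : Tendsto (fun i => (P i).map (f := (Nat.cast : ℕ → ℝ))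
      Measurable.of_discrete.aemeasurable) l
      (𝓝 (Q.map (f := (Nat.cast : ℕ → ℝ)) Measurable.of_discrete.aemeasurable))) :
    Tendsto P l (𝓝 Q) := by
  rw [ProbabilityMeasure.tendsto_iff_forall_integral_tendsto] at h ⊢
  intro f
  -- `ℕ` is closed in `ℝ`, so by Tietze every bounded continuous test function on `ℕ` extends to
  -- `ℝ`.
  obtain ⟨g, -, hg⟩ := f.exists_extension_norm_eq_of_isClosedEmbedding
    Nat.isClosedEmbedding_coe_real
  have h1 := h g
  have e : ∀ P : ProbabilityMeasure ℕ, ∫ x, g x ∂((P.map (f := (Nat.cast : ℕ → ℝ))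
      Measurable.of_discrete.aemeasurable : ProbabilityMeasure ℝ) : Measure ℝ) =
      ∫ n, f n ∂(P : Measure ℕ) := fun P => by
    rw [ProbabilityMeasure.toMeasure_map, integral_map Measurable.of_discrete.aemeasurable
      g.continuous.aestronglyMeasurable]
    exact integral_congr_ae (ae_of_all _ fun n => congrFun hg n)
  simpa only [e] using h1

theorem tendsto_natPred_atTop : Tendsto PNat.natPred atTop atTop :=
  OrderIso.pnatIsoNat.tendsto_atTop

theorem tendsto_probabilityMeasure_nat_of_charFun {P : ℕ+ → ProbabilityMeasure ℕ}
    {Q : ProbabilityMeasure ℕ}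
    (h : ∀ θ : ℝ, Tendsto (fun t => ∫ n : ℕ, Complex.exp (θ * Complex.I) ^ n ∂(P t : Measure ℕ))
      atTop (𝓝 (∫ n : ℕ, Complex.exp (θ * Complex.I) ^ n ∂(Q : Measure ℕ)))) :
    Tendsto P atTop (𝓝 Q) := by
  refine tendsto_probabilityMeasure_nat_of_map_cast ?_
  -- Lévy's theorem is applied to the sequence indexed by `ℕ` through `t = n + 1`.
  have h1 : Tendsto (fun n : ℕ => (P n.succPNat).map (f := (Nat.cast : ℕ → ℝ))
      Measurable.of_discrete.aemeasurable) atTop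
      (𝓝 (Q.map (f := (Nat.cast : ℕ → ℝ)) Measurable.of_discrete.aemeasurable)) := by
    refine ProbabilityMeasure.tendsto_of_tendsto_charFun fun θ => ?_
    simp only [ProbabilityMeasure.toMeasure_map, charFun_map_natCast]
    exact (h θ).comp (OrderIso.pnatIsoNat.symm.tendsto_atTop)
  have h2 := h1.comp tendsto_natPred_atTop
  simpa only [Function.comp_def, PNat.succPNat_natPred] using h2

theorem tendstoInDistribution_nat_of_charFun {D : ℕ+ → Ω → ℕ} (hD : ∀ t, AEMeasurable (D t) μ)
    (Q : Measure ℕ) [IsProbabilityMeasure Q]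
    (h : ∀ θ : ℝ, Tendsto (fun t => ∫ ω, Complex.exp (θ * Complex.I) ^ D t ω ∂μ) atTop
      (𝓝 (∫ n : ℕ, Complex.exp (θ * Complex.I) ^ n ∂Q))) :
    TendstoInDistribution D atTop (id : ℕ → ℕ) (fun _ => μ) Q where
  forall_aemeasurable := hD
  aemeasurable_limit := aemeasurable_id
  tendsto := by
    refine tendsto_probabilityMeasure_nat_of_charFun fun θ => ?_
    simp only [ProbabilityMeasure.coe_mk, Measure.map_id]
    refine (h θ).congr fun t => ?_
    rw [integral_map (hD t) Measurable.of_discrete.aestronglyMeasurable]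

end Levy

/-! ### Letting the truncation level go to infinity -/

theorem tendsto_of_forall_eventually_norm_sub_le {ι : Type*} {l : Filter ι} {f : ι → ℂ}
    {g : ℕ → ι → ℂ} {L : ℕ → ℂ} {c : ℂ} {r : ℕ → ℝ} (hg : ∀ n, Tendsto (g n) l (𝓝 (L n)))
    (hL : Tendsto L atTop (𝓝 c)) (hr : Tendsto r atTop (𝓝 0))
    (h : ∀ n, ∀ᶠ t in l, ‖f t - g n t‖ ≤ r n) : Tendsto f l (𝓝 c) := by
  rw [Metric.tendsto_nhds]
  intro ε hε
  obtain ⟨n, h1, h2⟩ := ((hr.eventually_lt_const (by positivity : 0 < ε / 3)).and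
    (Metric.tendsto_nhds.1 hL (ε / 3) (by positivity))).exists
  filter_upwards [h n, Metric.tendsto_nhds.1 (hg n) (ε / 3) (by positivity)] with t h3 h4
  have h5 := dist_triangle4 (f t) (g n t) (L n) c
  rw [dist_eq_norm (f t) (g n t)] at h5
  linarith

section Limit

variable {Ω : Type*} {mΩ : MeasurableSpace Ω} {μ : Measure Ω} {a b ν : ℝ} {X Y : ℕ+ → Ω → ℝ}
  {H : ℕ+ → ℕ+ → Set Ω}

theorem limitMean_nonneg (ha : 0 < a) (hab : a < b) (hν : 1 < ν)
    (hY0 : ∀ j, ∀ᵐ ω ∂μ, 0 ≤ Y j ω) : ∀ᵐ ω ∂μ, 0 ≤ limitMean μ a b ν X Y ω := by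
  filter_upwards [hY0 1] with ω hω
  exact mul_nonneg (mul_nonneg (mul_nonneg (gammaConst_nonneg ha hab hν)
    (integral_nonneg fun _ => sq_nonneg _)) (integral_nonneg_of_ae (hY0 1))) hω

theorem measurable_limitMean (hYm : ∀ j, Measurable (Y j)) :
    Measurable (limitMean μ a b ν X Y) :=
  (hYm 1).const_mul _

theorem tailMean_nonneg {M : ℝ} (hY0 : ∀ j, ∀ᵐ ω ∂μ, 0 ≤ Y j ω) : 0 ≤ tailMean μ X Y M := by
  have h1 : 0 ≤ ∫ ω, Y 1 ω ∂μ := integral_nonneg_of_ae (hY0 1)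
  have h2 : 0 ≤ ∫ ω, (Set.Icc 0 M)ᶜ.indicator id (Y 1 ω) ∂μ :=
    integral_nonneg_of_ae ((hY0 1).mono fun ω hω => Set.indicator_apply_nonneg fun _ => hω)
  have h3 : 0 ≤ ∫ ω, (Set.Icc 0 M)ᶜ.indicator (fun x => x ^ 2) (X 1 ω) ∂μ :=
    integral_nonneg fun ω => Set.indicator_nonneg (fun _ _ => sq_nonneg _) _
  have h4 : 0 ≤ ∫ ω, X 1 ω ^ 2 ∂μ := integral_nonneg fun _ => sq_nonneg _
  exact mul_nonneg (add_nonneg (mul_nonneg h3 h1) (mul_nonneg h4 h2)) h1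

theorem tendsto_limitMean_trunc (hXm : ∀ i, Measurable (X i)) (hYm : ∀ j, Measurable (Y j))
    (hX0 : ∀ i, ∀ᵐ ω ∂μ, 0 ≤ X i ω) (hY0 : ∀ j, ∀ᵐ ω ∂μ, 0 ≤ Y j ω)
    (hX2 : Integrable (fun ω => X 1 ω ^ 2) μ) (hY1 : Integrable (Y 1) μ) :
    ∀ᵐ ω ∂μ, Tendsto (fun n : ℕ => limitMean μ a b ν (fun i ω => trunc n (X i ω))
      (fun j ω => trunc n (Y j ω)) ω) atTop (𝓝 (limitMean μ a b ν X Y ω)) := by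
  have h1 : Tendsto (fun n : ℕ => ∫ ω, trunc n (X 1 ω) ^ 2 ∂μ) atTop
      (𝓝 (∫ ω, X 1 ω ^ 2 ∂μ)) := by
    refine tendsto_integral_of_dominated_convergence (fun ω => X 1 ω ^ 2) (fun n =>
      ((measurable_trunc.comp (hXm 1)).pow_const 2).aestronglyMeasurable) hX2
      (fun n => ae_of_all _ fun ω => ?_) ?_
    · rw [norm_pow, Real.norm_eq_abs, ← sq_abs (X 1 ω)]
      exact pow_le_pow_left₀ (abs_nonneg _) (abs_trunc_le _) 2
    · filter_upwards [hX0 1] with ω hω using (tendsto_trunc hω).pow 2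
  have h2 : Tendsto (fun n : ℕ => ∫ ω, trunc n (Y 1 ω) ∂μ) atTop (𝓝 (∫ ω, Y 1 ω ∂μ)) := by
    refine tendsto_integral_of_dominated_convergence (fun ω => |Y 1 ω|) (fun n =>
      (measurable_trunc.comp (hYm 1)).aestronglyMeasurable) hY1.abs
      (fun n => ae_of_all _ fun ω => abs_trunc_le _) ?_
    filter_upwards [hY0 1] with ω hω using tendsto_trunc hω
  filter_upwards [hY0 1] with ω hω
  exact ((h1.const_mul _).mul h2).mul (tendsto_trunc hω)

variable [IsProbabilityMeasure μ]

theorem tendsto_integral_exp_limitMean_trunc (ha : 0 < a) (hab : a < b) (hν : 1 < ν)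
    (hXm : ∀ i, Measurable (X i)) (hYm : ∀ j, Measurable (Y j))
    (hX0 : ∀ i, ∀ᵐ ω ∂μ, 0 ≤ X i ω) (hY0 : ∀ j, ∀ᵐ ω ∂μ, 0 ≤ Y j ω)
    (hX2 : Integrable (fun ω => X 1 ω ^ 2) μ) (hY1 : Integrable (Y 1) μ)
    {z : ℂ} (hz : ‖z‖ ≤ 1) :
    Tendsto (fun n : ℕ => ∫ ω, Complex.exp ((z - 1) * (limitMean μ a b ν
      (fun i ω => trunc n (X i ω)) (fun j ω => trunc n (Y j ω)) ω : ℝ)) ∂μ) atTop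
      (𝓝 (∫ ω, Complex.exp ((z - 1) * (limitMean μ a b ν X Y ω : ℝ)) ∂μ)) := by
  refine tendsto_integral_of_dominated_convergence (fun _ => 1) (fun n => ?_)
    (integrable_const _) (fun n => ?_) ?_
  · have : Measurable (limitMean μ a b ν (fun i ω => trunc n (X i ω))
        fun j ω => trunc n (Y j ω)) :=
      measurable_limitMean fun j => measurable_trunc.comp (hYm j)
    exact Measurable.aestronglyMeasurable (by fun_prop)
  · filter_upwards [limitMean_nonneg (X := fun i ω => trunc n (X i ω)) ha hab hν
      (fun j => ae_of_all μ fun ω => trunc_nonneg (M := n) (Y j ω))] with ω hω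
    exact norm_exp_le_one_of_re_nonpos (sub_one_mul_re_nonpos hz hω)
  · filter_upwards [tendsto_limitMean_trunc (a := a) (b := b) (ν := ν) hXm hYm hX0 hY0 hX2 hY1]
      with ω hω
    have hc : Continuous fun x : ℝ => Complex.exp ((z - 1) * (x : ℂ)) := by fun_prop
    exact (hc.tendsto _).comp hω

theorem tendsto_integral_pow_degree (ha : 0 < a) (hab : a < b) (hν : 1 < ν)
    (hXm : ∀ i, Measurable (X i)) (hYm : ∀ j, Measurable (Y j))
    (hX0 : ∀ i, ∀ᵐ ω ∂μ, 0 ≤ X i ω) (hY0 : ∀ j, ∀ᵐ ω ∂μ, 0 ≤ Y j ω)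
    (hindep : iIndepFun (Sum.elim X Y) μ)
    (hXid : ∀ i, IdentDistrib (X i) (X 1) μ μ) (hYid : ∀ j, IdentDistrib (Y j) (Y 1) μ μ)
    (hX2 : Integrable (fun ω => X 1 ω ^ 2) μ) (hY1 : Integrable (Y 1) μ)
    (hH : IsRandomBipartiteGraph μ a b (fun t => (t : ℝ) ^ ν) X Y H) {z : ℂ} (hz : ‖z‖ ≤ 1) :
    Tendsto (fun t => ∫ ω, z ^ degree H t ω ∂μ) atTop
      (𝓝 (∫ ω, Complex.exp ((z - 1) * (limitMean μ a b ν X Y ω : ℝ)) ∂μ)) := by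
  -- `gammaConst a b ν + 1` bounds the total path weight for all large `t`.
  have hr : Tendsto (fun n : ℕ => 2 * (∫ ω, (Set.Icc 0 (n : ℝ))ᶜ.indicator 1 (Y 1 ω) ∂μ +
      (gammaConst a b ν + 1) * tailMean μ X Y n)) atTop (𝓝 0) := by
    have h1 := tendsto_integral_indicator_compl_Icc (μ := μ) (hYm 1) (hY0 1) (f := 1)
      measurable_one (integrable_const 1)
    simpa only [mul_zero, add_zero] using (h1.add
      ((tendsto_tailMean hXm hYm hX0 hY0 hX2 hY1).const_mul (gammaConst a b ν + 1))).const_mul 2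
  refine tendsto_of_forall_eventually_norm_sub_le (fun n => (isBoundedModel_trunc ha hab hν
    (Nat.cast_nonneg n) hXm hYm hindep hXid hYid hH).tendsto_integral_pow_degree hz)
    (tendsto_integral_exp_limitMean_trunc ha hab hν hXm hYm hX0 hY0 hX2 hY1 hz) hr fun n => ?_
  filter_upwards [(tendsto_sum_pathWeight ha hab hν).eventually_le_const
    (lt_add_one (gammaConst a b ν))] with t ht
  refine (norm_integral_pow_degree_sub_truncEdge_le ha hab hν hXm hYm hX0 hY0 hindep hXid hYid
    hX2 hY1 hH (Nat.cast_nonneg n) hz t).trans ?_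
  have := tailMean_nonneg (X := X) (M := n) hY0
  gcongr

end Limit

end RandomIntersection

/-! ### The theorem -/

open RandomIntersection

theorem theorem2 {Ω : Type*} {mΩ : MeasurableSpace Ω} (μ : Measure Ω) [IsProbabilityMeasure μ]
    (a b ν : ℝ) (ha : 0 < a) (hab : a < b) (hν : 1 < ν)
    (X Y : ℕ+ → Ω → ℝ)
    (hXm : ∀ i, Measurable (X i)) (hYm : ∀ j, Measurable (Y j))
    (hX0 : ∀ i, ∀ᵐ ω ∂μ, 0 ≤ X i ω) (hY0 : ∀ j, ∀ᵐ ω ∂μ, 0 ≤ Y j ω)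
    -- all the variables `X_i`, `Y_j` together are independent
    (hindep : iIndepFun (Sum.elim X Y) μ)
    (hXid : ∀ i, IdentDistrib (X i) (X 1) μ μ) (hYid : ∀ j, IdentDistrib (Y j) (Y 1) μ μ)
    (hX2 : Integrable (fun ω => X 1 ω ^ 2) μ) (hY1 : Integrable (Y 1) μ)
    (H : ℕ+ → ℕ+ → Set Ω)
    (hH : RandomIntersection.IsRandomBipartiteGraph μ a b (fun t => (t : ℝ) ^ ν) X Y H) :
    -- the degrees are almost surely finite
    (∀ᵐ ω ∂μ, ∀ t, ((RandomIntersection.intersectionGraph H ω).neighborSet t).Finite) ∧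
    -- there is a probability law on `ℕ`, that of `Λ₃`, with the mixed Poisson weights,
    -- and `d(v_t)` converges in distribution to it
    ∃ (Q : Measure ℕ) (_ : IsProbabilityMeasure Q),
      (∀ r : ℕ, Q.real {r} =
        ∫ ω, Real.exp (-RandomIntersection.limitMean μ a b ν X Y ω) *
          RandomIntersection.limitMean μ a b ν X Y ω ^ r / (r.factorial : ℝ) ∂μ) ∧
      TendstoInDistribution (fun (t : ℕ+) (ω : Ω) => RandomIntersection.degree H t ω) atTop
        (id : ℕ → ℕ) (fun _ => μ) Q := by
  have hmom := hasEdgeMoments_of_isRandomBipartiteGraph hXm hYm hH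
  refine ⟨?_, mixedPoisson μ _ (measurable_limitMean hYm), inferInstance,
    mixedPoisson_real_singleton μ _ (limitMean_nonneg ha hab hν hY0),
    tendstoInDistribution_nat_of_charFun
      (aemeasurable_degree ha hab hν hH.measurableSet_edge hmom) _ fun θ => ?_⟩
  · filter_upwards [hmom.ae_inBand] with ω hω t
    rw [neighborSet_eq_image_paths ha hab hν hω]
    exact Finset.finite_toSet _
  -- On the unit circle both sides are generating functions at a `z` with `‖z‖ = 1`.
  · rw [integral_pow_mixedPoisson μ _ (limitMean_nonneg ha hab hν hY0)]
    exact tendsto_integral_pow_degree ha hab hν hXm hYm hX0 hY0 hindep hXid hYid hX2 hY1 hH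
      (Complex.norm_exp_ofReal_mul_I θ).le
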